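/- **Definitions.** The variation $S(u)\in\{0,1,2,\dots\}\cup\{\infty\}$ of a real vector or sequence $u$ is the number of sign changes in $u$ after deleting its zeros ($S(0)=0$). A linear map $X$ is *order-preserving $k$-variation diminishing* ($\mathrm{OVD}_k$) if for every $u$ in its domain with $S(u)\le k$: (i) $S(Xu)\le S(u)$; and (ii) if $S(Xu)=S(u)$, and $u$ and $Xu$ are both nonzero, then the first nonzero entries of $u$ and of $Xu$ have the same sign. For $X\in\mathbb R^{n\times m}$, the $r$-th multiplicative compound $X_{[r]}\in\mathbb R^{\binom nr\times\binom mr}$ is the matrix of all $r$-minors of $X$, with rows and columns indexed by the $r$-element subsets of $\{1,\dots,n\}$ and $\{1,\dots,m\}$; $X$ is called *$k$-positive* if $X_{[j]}\ge 0$ entrywise for $1\le j\le k$ (minors of order exceeding $\min\{n,m\}$ do not exist and impose no condition). For a matrix $P$, $\operatorname{cone}(P)=\{Px : x\ge 0\}$, and $\mathcal K^*=\{y : y^{\mathsf T}x\ge 0 \text{ for all } x\in\mathcal K\}$ is the dual cone of $\mathcal K$. Let $G(z)$ be a real rational function. A triple $(A,b,c)$ with $A\in\mathbb R^{n\times n}$,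 $b,c^{\mathsf T}\in\mathbb R^n$ and all eigenvalues of $A$ in the open unit disc is a *realization* of $G$ if $G(z)=\sum_{t\ge 0}g(t)z^{-t}$ for $|z|\ge 1$, where $g$ is the impulse response of $x(t+1)=Ax(t)+bu(t)$, $y(t)=cx(t)$, i.e. $g(0)=0$ and $g(t)=cA^{t-1}b$ for $t\ge1$. It is *minimal* if the eigenvalues of $A$ are precisely the poles of $G$, both counted with multiplicity. Put $$\mathcal C(A,b)u=\sum_{t\le -1}A^{-t-1}b\,u(t),\qquad (\mathcal O(A,c)x_0)(t)=cA^tx_0\quad(t\ge 0),$$ for bounded inputs $u$ (whose entries are listed in the order $u(-1),u(-2),\dots$ when variation and first nonzero entry are determined) and $x_0\in\mathbb R^n$. For $k\ge1$, $(A,b,c)$ is *internally Hankel $k$-positive* if $A$, $\mathcal C(A,b)$ and $\mathcal O(A,c)$ are $\mathrm{OVD}_{k-1}$. Finally let $\mathcal C^j(A,b)=\begin{pmatrix}b&Ab&\cdots&A^{j-1}b\end{pmatrix}$ and $\mathcal O^j(A,c)=\mathcal C^j(A^{\mathsf T},c^{\mathsf T})^{\mathsf T}$. **Theorem.** Let $k\ge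 1$ and let $(A,b,c)$, with $A\in\mathbb R^{n\times n}$, be a minimal realization of $G(z)$. Then $G(z)$ has a minimal realization that is internally Hankel $k$-positive if and only if there exist $P\in\mathbb R^{n\times n}$ with $\operatorname{rank}(P)=n$ and a $k$-positive $N\in\mathbb R^{n\times n}$ such that $AP=PN$ and, for all $1\le j\le k$, $$\mathcal C^j(A,b)_{[j]}\in\operatorname{cone}(P_{[j]}),\qquad \bigl(\mathcal O^j(A,c)_{[j]}\bigr)^{\mathsf T}\in\operatorname{cone}(P_{[j]})^*.$$ -/

import Mathlib

open scoped Matrix ENNReal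

noncomputable section

namespace HankelPos

/-! ### Variation and order-preserving variation diminishing maps -/

/-- The number of sign changes of `u` after deletion of its zeros: pairs `i < j` of indices whose
entries have opposite signs and between which `u` vanishes. -/
def variation {ι : Type*} [LinearOrder ι] (u : ι → ℝ) : ℕ∞ :=
  Set.encard {p : ι × ι | p.1 < p.2 ∧ u p.1 * u p.2 < 0 ∧ ∀ l, p.1 < l → l < p.2 → u l = 0}

/-- `i` is the position of the first nonzero element of `u`. -/
def IsFirstNonzero {ι : Type*} [LinearOrder ι] (u : ι → ℝ) (i : ι) : Prop :=
  u i ≠ 0 ∧ ∀ l, l < i → u l = 0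

/-- The map `u ↦ X u`, with domain `D`, is order-preserving `k`-variation diminishing. The sign
condition is void if `u` or `X u` is zero and so has no first nonzero element. -/
def IsOVD {ι κ : Type*} [LinearOrder ι] [LinearOrder κ] (k : ℕ) (D : Set (ι → ℝ))
    (X : (ι → ℝ) → (κ → ℝ)) : Prop :=
  ∀ u ∈ D, variation u ≤ k →
    variation (X u) ≤ variation u ∧
    (variation (X u) = variation u →
      ∀ i j, IsFirstNonzero u i → IsFirstNonzero (X u) j →
        SignType.sign (u i) = SignType.sign (X u j))

/-! ### Compound matrices, `k`-positive matrices and cones -/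

/-- The `r`-th multiplicative compound matrix, the matrix of all `r`-minors of `X`. An increasing
map `Fin r ↪o Fin n` is an `r`-element subset of the index set. -/
def compound {n m : ℕ} (X : Matrix (Fin n) (Fin m) ℝ) (r : ℕ) :
    Matrix (Fin r ↪o Fin n) (Fin r ↪o Fin m) ℝ :=
  Matrix.of fun I J => (X.submatrix I J).det

/-- All minors of `X` of order `1, …, k` are nonnegative. -/
def IsKPositive {n m : ℕ} (k : ℕ) (X : Matrix (Fin n) (Fin m) ℝ) : Prop :=
  ∀ j, 1 ≤ j → j ≤ k → ∀ I J, 0 ≤ compound X j I J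

/-- The polyhedral cone `{P x | x ≥ 0}` generated by the columns of `P`. -/
def cone {ι κ : Type*} [Fintype κ] (P : Matrix ι κ ℝ) : Set (ι → ℝ) :=
  {y | ∃ x : κ → ℝ, (∀ i, 0 ≤ x i) ∧ y = P *ᵥ x}

/-- The dual cone of `K`. -/
def dualCone {ι : Type*} [Fintype ι] (K : Set (ι → ℝ)) : Set (ι → ℝ) :=
  {y | ∀ x ∈ K, 0 ≤ y ⬝ᵥ x}

/-! ### Linear discrete-time systems `x(t+1) = A x(t) + b u(t)`, `y(t) = c x(t)` -/

variable {n : ℕ}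

/-- The state `x(t)` for the input `u` and the initial state `x(0) = 0`. -/
def state (A : Matrix (Fin n) (Fin n) ℝ) (b : Fin n → ℝ) (u : ℕ → ℝ) : ℕ → Fin n → ℝ
  | 0 => 0
  | t + 1 => A *ᵥ state A b u t + u t • b

/-- The impulse response: the output `y(t) = c x(t)` for the unit pulse input. -/
def impulseResponse (A : Matrix (Fin n) (Fin n) ℝ) (b c : Fin n → ℝ) (t : ℕ) : ℝ :=
  c ⬝ᵥ state A b (Pi.single 0 1) t

theorem impulseResponse_zero (A : Matrix (Fin n) (Fin n) ℝ) (b c : Fin n → ℝ) :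
    impulseResponse A b c 0 = 0 := by
  simp [impulseResponse, state]

theorem impulseResponse_succ (A : Matrix (Fin n) (Fin n) ℝ) (b c : Fin n → ℝ) (t : ℕ) :
    impulseResponse A b c (t + 1) = c ⬝ᵥ (A ^ t *ᵥ b) := by
  have h : ∀ t, state A b (Pi.single 0 1) (t + 1) = A ^ t *ᵥ b := by
    intro t
    induction t with
    | zero => simp [state]
    | succ t ih =>
      rw [state, ih]
      simp [pow_succ', Matrix.mulVec_mulVec]
  rw [impulseResponse, h]

/-- All eigenvalues of `A` lie in the open unit disc. -/
def IsStable (A : Matrix (Fin n) (Fin n) ℝ) : Prop :=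
  ∀ z ∈ spectrum ℂ (A.map (algebraMap ℝ ℂ)), ‖z‖ < 1

/-- `(A, b, c)`, with `A` stable, is a realization of the rational transfer function `G`:
`G(z) = ∑ g(t) z⁻ᵗ` for `|z| ≥ 1`, where `g` is the impulse response of `(A, b, c)`. -/
def IsRealization (G : RatFunc ℝ) (A : Matrix (Fin n) (Fin n) ℝ) (b c : Fin n → ℝ) : Prop :=
  IsStable A ∧ ∀ z : ℂ, 1 ≤ ‖z‖ →
    HasSum (fun t : ℕ => (impulseResponse A b c t : ℂ) / z ^ t) (G.eval (algebraMap ℝ ℂ) z)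

/-- The poles of `G` with multiplicity (numerator and denominator of `G` are coprime). -/
def poles (G : RatFunc ℝ) : Multiset ℂ :=
  (G.denom.map (algebraMap ℝ ℂ)).roots

/-- A realization is minimal if the eigenvalues of `A`, counted with algebraic multiplicity, are
precisely the poles of `G`, counted with multiplicity. -/
def IsMinimalRealization (G : RatFunc ℝ) (A : Matrix (Fin n) (Fin n) ℝ) (b c : Fin n → ℝ) :
    Prop :=
  IsRealization G A b c ∧ (A.map (algebraMap ℝ ℂ)).charpoly.roots = poles G

/-- The controllability operator `u ↦ x(0) = ∑_{t ≤ -1} A^{-t-1} b u(t)`. The past input is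
listed backwards in time: `u i` is the input at time `-(i + 1)`. -/
def ctrbOp (A : Matrix (Fin n) (Fin n) ℝ) (b : Fin n → ℝ) (u : ℕ → ℝ) : Fin n → ℝ :=
  ∑' i : ℕ, u i • (A ^ i *ᵥ b)

/-- The observability operator `x₀ ↦ (c Aᵗ x₀)_{t ≥ 0}`. -/
def obsvOp (A : Matrix (Fin n) (Fin n) ℝ) (c : Fin n → ℝ) (x₀ : Fin n → ℝ) : ℕ → ℝ :=
  fun t => c ⬝ᵥ (A ^ t *ᵥ x₀)

/-- `(A, b, c)` is internally Hankel `k`-positive (`k ≥ 1`): `A`, the controllability operator on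
bounded inputs and the observability operator are order-preserving `(k-1)`-variation
diminishing. -/
def IsInternallyHankelKPositive (k : ℕ) (A : Matrix (Fin n) (Fin n) ℝ) (b c : Fin n → ℝ) :
    Prop :=
  IsOVD (k - 1) Set.univ (fun x : Fin n → ℝ => A *ᵥ x) ∧
  IsOVD (k - 1) {u : ℕ → ℝ | Memℓp u ∞} (ctrbOp A b) ∧
  IsOVD (k - 1) Set.univ (obsvOp A c)

/-- The matrix `(b, A b, …, A^{j-1} b)`. -/
def ctrbMatrix (A : Matrix (Fin n) (Fin n) ℝ) (b : Fin n → ℝ) (j : ℕ) :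
    Matrix (Fin n) (Fin j) ℝ :=
  Matrix.of fun i t => (A ^ (t : ℕ) *ᵥ b) i

/-- The matrix with rows `c, c A, …, c A^{j-1}`. -/
def obsvMatrix (A : Matrix (Fin n) (Fin n) ℝ) (c : Fin n → ℝ) (j : ℕ) :
    Matrix (Fin j) (Fin n) ℝ :=
  (ctrbMatrix Aᵀ c j)ᵀ

/-- The `j`-th compound of `ctrbMatrix A b j`, which has a single column, as a vector. -/
def ctrbCompound (A : Matrix (Fin n) (Fin n) ℝ) (b : Fin n → ℝ) (j : ℕ) :
    (Fin j ↪o Fin n) → ℝ :=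
  fun I => compound (ctrbMatrix A b j) j I (RelEmbedding.refl (· ≤ ·))

/-- The transpose of the `j`-th compound of `obsvMatrix A c j`, which has a single row, as a
vector. -/
def obsvCompound (A : Matrix (Fin n) (Fin n) ℝ) (c : Fin n → ℝ) (j : ℕ) :
    (Fin j ↪o Fin n) → ℝ :=
  fun J => compound (obsvMatrix A c j) j (RelEmbedding.refl (· ≤ ·)) J

end HankelPos

end

/-! The bridge is the variation-diminishing characterization of total nonnegativity: a linear map is
order-preserving `(k-1)`-variation diminishing exactly when all its minors of order at most `k` are
nonnegative (`isOVD_matrix_iff`, `isOVD_tsum_iff`). Internal Hankel `k`-positivity thus says that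
`A`, the infinite matrix `(b, Ab, A²b, …)` and its observability counterpart have nonnegative minors
up to order `k`.

For necessity, two minimal realizations are similar (`IsMinimalRealization.exists_similarity`). The
similarity serves as `P`, the state matrix of the positive realization as `N`, and Cauchy–Binet
(`compound_mul`) turns nonnegative minors into the two cone conditions.

For sufficiency, `P` is used as a change of coordinates, which leaves state matrix `N`. The cone
conditions then say only that the maximal minors of `(b', Nb', …, N^{j-1}b')` and of its
observability analogue are nonnegative for `j ≤ k`. The heart of the proof,
`isTotallyNonneg_ctrbKernel`, extends this to arbitrary increasing exponents. Consecutive exponents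
`s, …, s+r-1` are reached by multiplying with `N^s`; arbitrary ones by Fekete's criterion
(`det_pos_of_consecutive`), which needs strict positivity. Strictness comes from multiplying on the
left by a totally positive matrix that tends to the identity. If `N` is singular, some families of
columns are dependent and their minors stay zero; Fekete's criterion is therefore stated relative to
a class of admissible column sets that excludes them. -/

namespace HankelPos

/-! ### Sign changes expressed through alternating subsequences. -/

section Patterns

variable {ι κ : Type*} [LinearOrder ι] [LinearOrder κ]

/-- `u` has `p + 1` entries of strictly alternating signs, the first having the sign of `σ`. -/
def Alternates (u : ι → ℝ) (p : ℕ) (σ : ℝ) : Prop :=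
  ∃ I : Fin (p + 1) → ι, StrictMono I ∧ ∀ s : Fin (p + 1), 0 < σ * (-1) ^ (s : ℕ) * u (I s)

theorem Alternates.tail {u : ι → ℝ} {p : ℕ} {σ : ℝ} (h : Alternates u (p + 1) σ) :
    Alternates u p (-σ) := by
  obtain ⟨I, hI, h⟩ := h
  refine ⟨fun s => I s.succ, fun a b hab => hI (Fin.succ_lt_succ_iff.2 hab), fun s => ?_⟩
  have := h s.succ
  rw [Fin.val_succ, pow_succ] at this
  linarith

theorem Alternates.init {u : ι → ℝ} {p : ℕ} {σ : ℝ} (h : Alternates u (p + 1) σ) :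
    Alternates u p σ := by
  obtain ⟨I, hI, h⟩ := h
  exact ⟨fun s => I s.castSucc, fun a b hab => hI hab, fun s => by simpa using h s.castSucc⟩

theorem Alternates.mono {u : ι → ℝ} {p q : ℕ} {σ : ℝ} (h : Alternates u q σ) (hpq : p ≤ q) :
    Alternates u p σ := by
  induction q, hpq using Nat.le_induction with
  | base => exact h
  | succ q _ ih => exact ih h.init

theorem Alternates.of_same_sign {u : ι → ℝ} {p : ℕ} {σ τ : ℝ} (h : Alternates u p σ)
    (hτ : 0 < σ * τ) : Alternates u p τ := by
  obtain ⟨I, hI, h⟩ := h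
  refine ⟨I, hI, fun s => ?_⟩
  have h1 := mul_pos (h s) hτ
  have hσ : 0 < σ * σ := mul_self_pos.2 (left_ne_zero_of_mul hτ.ne')
  refine pos_of_mul_pos_right (a := σ * σ) ?_ hσ.le
  linarith

/-- With a sign change to spare, either the first or the last entry of a pattern can be dropped, and
the two choices start with opposite signs. Only patterns of maximal length therefore carry
information about the leading sign. -/
theorem Alternates.of_lt {u : ι → ℝ} {p q : ℕ} {σ τ : ℝ} (h : Alternates u q σ) (hpq : p < q)
    (hτ : τ ≠ 0) : Alternates u p τ := by
  have h1 := h.mono (Nat.succ_le_of_lt hpq)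
  have hσ : σ ≠ 0 := by
    rintro rfl
    obtain ⟨I, -, h⟩ := h
    simpa using h 0
  rcases lt_or_gt_of_ne (mul_ne_zero hσ hτ) with hneg | hpos
  · exact h1.tail.of_same_sign (by linarith)
  · exact h1.init.of_same_sign hpos

theorem alternates_zero_iff {u : ι → ℝ} {σ : ℝ} :
    Alternates u 0 σ ↔ ∃ i, 0 < σ * u i := by
  constructor
  · rintro ⟨I, -, h⟩
    exact ⟨I 0, by simpa using h 0⟩
  · rintro ⟨i, hi⟩
    exact ⟨fun _ => i, Subsingleton.strictMono (α := Fin 1) _, fun s => by simpa [Fin.fin_one_eq_zero s] using hi⟩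

/-- A finite set of positions of nonzero entries splits into consecutive blocks of constant sign,
with signs alternating from one block to the next. -/
theorem exists_sign_blocks (u : ι → ℝ) (s : Finset ι) (hs : s.Nonempty) (hu : ∀ i ∈ s, u i ≠ 0) :
    ∃ (q : ℕ) (σ : ℝ) (blk : ι → ℕ), (σ = 1 ∨ σ = -1) ∧ MonotoneOn blk s ∧
      s.image blk = Finset.range (q + 1) ∧ ∀ i ∈ s, 0 < σ * (-1) ^ (blk i) * u i := by
  classical
  induction s using Finset.induction_on_max with
  | empty => simp at hs
  | insert a s ha ih =>
    rcases s.eq_empty_or_nonempty with rfl | hne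
    · obtain ⟨σ, hσ, h⟩ : ∃ σ : ℝ, (σ = 1 ∨ σ = -1) ∧ 0 < σ * u a := by
        rcases lt_or_gt_of_ne (hu a (by simp)) with h | h
        · exact ⟨-1, Or.inr rfl, by linarith⟩
        · exact ⟨1, Or.inl rfl, by linarith⟩
      exact ⟨0, σ, fun _ => 0, hσ, monotoneOn_const, by simp, by simpa using h⟩
    · obtain ⟨q, σ, blk, hσ, hmono, himg, hsgn⟩ :=
        ih hne (fun i hi => hu i (Finset.mem_insert_of_mem hi))
      have hle : ∀ i ∈ s, blk i ≤ q := fun i hi =>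
        Nat.lt_succ_iff.1 (Finset.mem_range.1 (himg ▸ Finset.mem_image_of_mem blk hi))
      have has : a ∉ s := fun h => lt_irrefl _ (ha a h)
      have hua : u a ≠ 0 := hu a (Finset.mem_insert_self _ _)
      have hσ0 : σ ≠ 0 := by rcases hσ with rfl | rfl <;> norm_num
      obtain ⟨v, hv, hva⟩ : ∃ v, (v = q ∨ v = q + 1) ∧ 0 < σ * (-1) ^ v * u a := by
        rcases lt_or_gt_of_ne
          (mul_ne_zero (mul_ne_zero hσ0 (pow_ne_zero q (by norm_num : (-1 : ℝ) ≠ 0))) hua) with h | h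
        · exact ⟨q + 1, Or.inr rfl, by rw [pow_succ]; linarith⟩
        · exact ⟨q, Or.inl rfl, h⟩
      have hupd : ∀ i ∈ s, Function.update blk a v i = blk i := fun i hi =>
        Function.update_of_ne (fun h : i = a => has (h ▸ hi)) _ _
      refine ⟨v, σ, Function.update blk a v, hσ, ?_, ?_, ?_⟩
      · intro i hi j hj hij
        rcases Finset.mem_insert.1 hi with rfl | hi'
        · rcases Finset.mem_insert.1 hj with rfl | hj
          · exact le_rfl
          · exact absurd hij (not_le.2 (ha j hj))
        · rcases Finset.mem_insert.1 hj with rfl | hj'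
          · rw [hupd i hi', Function.update_self]
            have := hle i hi'
            omega
          · rw [hupd i hi', hupd j hj']
            exact hmono hi' hj' hij
      · rw [Finset.image_insert, Function.update_self, Finset.image_congr (fun i hi => hupd i hi),
          himg]
        ext x
        simp only [Finset.mem_insert, Finset.mem_range]
        omega
      · intro i hi
        rcases Finset.mem_insert.1 hi with rfl | hi
        · simpa using hva
        · rw [hupd i hi]; exact hsgn i hi

theorem alternates_of_sign_blocks {u : ι → ℝ} {s : Finset ι} {q : ℕ} {σ : ℝ} {blk : ι → ℕ}
    (hmono : MonotoneOn blk s) (himg : s.image blk = Finset.range (q + 1))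
    (hsgn : ∀ i ∈ s, 0 < σ * (-1) ^ (blk i) * u i) : Alternates u q σ := by
  have : ∀ l : Fin (q + 1), ∃ i ∈ s, blk i = l := fun l => by
    have : (l : ℕ) ∈ s.image blk := himg ▸ Finset.mem_range.2 l.2
    simpa using this
  choose I hI hb using this
  refine ⟨I, fun a b hab => ?_, fun l => hb l ▸ hsgn _ (hI l)⟩
  by_contra hle
  have := hmono (hI b) (hI a) (not_lt.1 hle)
  rw [hb, hb] at this
  exact absurd hab (not_lt.2 this)

/-- Cut the endpoints of `p + 1` sign changes into sign blocks: each change goes from one block to a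
later one, and different changes leave different blocks, so there are at least `p + 2` blocks. The
bound `p + 1` instead of `p` matters, since the zero sequence has variation `0` but contains no
pattern. -/
theorem exists_alternates_of_lt_variation {u : ι → ℝ} {p : ℕ}
    (h : ((p + 1 : ℕ) : ℕ∞) ≤ variation u) : ∃ σ, (σ = 1 ∨ σ = -1) ∧ Alternates u (p + 1) σ := by
  classical
  obtain ⟨T, hT, hcard⟩ := Set.exists_subset_encard_eq h
  have hfin : T.Finite := Set.finite_of_encard_eq_coe hcard
  lift T to Finset (ι × ι) using hfin
  rw [Set.encard_coe_eq_coe_finsetCard, Nat.cast_inj] at hcard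
  have hne : ∀ P ∈ T, u P.1 ≠ 0 ∧ u P.2 ≠ 0 := fun P hP => by
    have := (hT hP).2.1
    exact ⟨left_ne_zero_of_mul this.ne, right_ne_zero_of_mul this.ne⟩
  set s : Finset ι := T.image Prod.fst ∪ T.image Prod.snd with hs
  have h1 : ∀ P ∈ T, P.1 ∈ s := fun P hP => Finset.mem_union_left _ (Finset.mem_image_of_mem _ hP)
  have h2 : ∀ P ∈ T, P.2 ∈ s := fun P hP => Finset.mem_union_right _ (Finset.mem_image_of_mem _ hP)
  have hTne : T.Nonempty := Finset.card_pos.1 (by omega)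
  obtain ⟨P0, hP0⟩ := hTne
  obtain ⟨q, σ, blk, hσ, hmono, himg, hsgn⟩ := exists_sign_blocks u s ⟨_, h1 P0 hP0⟩ (by
    intro i hi
    rcases Finset.mem_union.1 hi with hi | hi <;> obtain ⟨P, hP, rfl⟩ := Finset.mem_image.1 hi
    · exact (hne P hP).1
    · exact (hne P hP).2)
  have hlt : ∀ P ∈ T, blk P.1 < blk P.2 := fun P hP => by
    refine lt_of_le_of_ne (hmono (h1 P hP) (h2 P hP) (hT hP).1.le) fun heq => ?_
    have a1 := hsgn _ (h1 P hP)
    have a2 := hsgn _ (h2 P hP)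
    rw [← heq] at a2
    have := mul_pos a1 a2
    have h3 := (hT hP).2.1
    nlinarith [mul_self_nonneg (σ * (-1) ^ blk P.1)]
  -- No nonzero entry lies strictly inside a sign change, so a change that starts later also starts
  -- after the end of the earlier one, hence in a later block.
  have key : ∀ P ∈ T, ∀ Q ∈ T, blk P.1 = blk Q.1 → P.1 ≤ Q.1 → P = Q := by
    intro P hP Q hQ hb hle
    rcases hle.lt_or_eq with hlt' | heq
    · have : P.2 ≤ Q.1 := by
        by_contra hcon
        exact (hne Q hQ).1 ((hT hP).2.2 _ hlt' (not_le.1 hcon))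
      have := hmono (h2 P hP) (h1 Q hQ) this
      have := hlt P hP
      omega
    · refine Prod.ext heq (le_antisymm ?_ ?_)
      · by_contra hcon
        exact (hne Q hQ).2 ((hT hP).2.2 _ (heq ▸ (hT hQ).1) (not_le.1 hcon))
      · by_contra hcon
        exact (hne P hP).2 ((hT hQ).2.2 _ (heq ▸ (hT hP).1) (not_le.1 hcon))
  have hcardle : T.card ≤ q := by
    rw [← Finset.card_range q]
    refine Finset.card_le_card_of_injOn (fun P => blk P.1) (fun P hP => ?_) fun P hP Q hQ hb => ?_
    · have hb : blk P.2 ∈ s.image blk := Finset.mem_image_of_mem _ (h2 P hP)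
      rw [himg, Finset.mem_range] at hb
      have := hlt P hP
      simp only [Finset.coe_range, Set.mem_Iio]
      omega
    · rcases le_total P.1 Q.1 with h | h
      · exact key P hP Q hQ hb h
      · exact (key Q hQ P hP hb.symm h).symm
  exact ⟨σ, hσ, (alternates_of_sign_blocks hmono himg hsgn).mono (hcard ▸ hcardle)⟩

/-- Take the last position up to `j` with the sign of `u i`, and then the next nonzero position
after it. -/
theorem exists_sign_change [LocallyFiniteOrder ι] {u : ι → ℝ} {i j : ι} (hij : i < j)
    (h : u i * u j < 0) :
    ∃ a b, i ≤ a ∧ b ≤ j ∧ a < b ∧ u a * u b < 0 ∧ ∀ l, a < l → l < b → u l = 0 := by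
  classical
  have hi0 : u i ≠ 0 := left_ne_zero_of_mul h.ne
  have hj0 : u j ≠ 0 := right_ne_zero_of_mul h.ne
  set S := (Finset.Icc i j).filter (fun x => 0 < u x * u i) with hS
  have hSi : S.Nonempty := ⟨i, by simp [hS, hij.le, hi0]⟩
  obtain ⟨haS, hamax⟩ := And.intro (S.max'_mem hSi) (S.le_max')
  set a := S.max' hSi
  simp only [hS, Finset.mem_filter, Finset.mem_Icc] at haS hamax
  obtain ⟨⟨hia, haj⟩, hpos⟩ := haS
  have haj' : a < j := lt_of_le_of_ne haj fun e => by rw [e] at hpos; linarith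
  set R := (Finset.Ioc a j).filter (fun x => u x ≠ 0) with hR
  have hRi : R.Nonempty := ⟨j, by simp [hR, haj', hj0]⟩
  obtain ⟨hbR, hbmin⟩ := And.intro (R.min'_mem hRi) (R.min'_le)
  set b := R.min' hRi
  simp only [hR, Finset.mem_filter, Finset.mem_Ioc] at hbR hbmin
  obtain ⟨⟨hab, hbj⟩, hb0⟩ := hbR
  refine ⟨a, b, hia, hbj, hab, ?_, fun l hal hlb => ?_⟩
  · have hnot : ¬ 0 < u b * u i := fun hc =>
      absurd (hamax b ⟨⟨hia.trans hab.le, hbj⟩, hc⟩) (not_le.2 hab)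
    have hneg : u b * u i < 0 := lt_of_le_of_ne (not_lt.1 hnot) (mul_ne_zero hb0 hi0)
    have := mul_neg_of_pos_of_neg hpos hneg
    nlinarith [mul_self_pos.2 hi0]
  · by_contra hl
    exact absurd (hbmin l ⟨⟨hal, hlb.le.trans hbj⟩, hl⟩) (not_le.2 hlb)

theorem Alternates.le_variation [LocallyFiniteOrder ι] {u : ι → ℝ} {p : ℕ} {σ : ℝ}
    (h : Alternates u p σ) : (p : ℕ∞) ≤ variation u := by
  obtain ⟨I, hI, h⟩ := h
  have : ∀ l : Fin p, ∃ a b, I l.castSucc ≤ a ∧ b ≤ I l.succ ∧ a < b ∧ u a * u b < 0 ∧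
      ∀ l, a < l → l < b → u l = 0 := fun l => by
    refine exists_sign_change (hI l.castSucc_lt_succ) ?_
    have h1 := h l.castSucc
    have h2 := h l.succ
    rw [Fin.val_succ, pow_succ] at h2
    rw [Fin.val_castSucc] at h1
    have := mul_pos h1 h2
    nlinarith [mul_self_nonneg (σ * (-1) ^ (l : ℕ))]
  choose a b ha hb hab hneg hz using this
  have hmono : StrictMono a := fun l l' hll => calc
    a l < b l := hab l
    _ ≤ I l.succ := hb l
    _ ≤ I l'.castSucc := hI.monotone (Fin.succ_le_castSucc_iff.2 hll)
    _ ≤ a l' := ha l'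
  have hinj : Function.Injective fun l => (a l, b l) := fun l l' hll =>
    hmono.injective (Prod.ext_iff.1 hll).1
  calc (p : ℕ∞) = (Set.range fun l => (a l, b l)).encard := by
        rw [← Set.image_univ, hinj.encard_image, Set.encard_univ]
        simp
    _ ≤ variation u := by
      refine Set.encard_le_encard ?_
      rintro _ ⟨l, rfl⟩
      exact ⟨hab l, hneg l, hz l⟩

/-- If the first nonzero entry had the opposite sign, prepending it would give a pattern with more
changes than the variation allows. -/
theorem Alternates.pos_first [LocallyFiniteOrder ι] {u : ι → ℝ} {p : ℕ} {σ : ℝ}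
    (h : Alternates u p σ) (hp : variation u = p) {i : ι} (hi : IsFirstNonzero u i) :
    0 < σ * u i := by
  obtain ⟨I, hI, h⟩ := h
  have hne : ∀ s, u (I s) ≠ 0 := fun s hs => by simpa [hs] using h s
  have hile : i ≤ I 0 := by
    by_contra hlt
    exact hne 0 (hi.2 _ (not_le.1 hlt))
  have h0 : 0 < σ * u (I 0) := by simpa using h 0
  by_contra hcon
  have hσ : σ ≠ 0 := left_ne_zero_of_mul h0.ne'
  have hneg : σ * u i < 0 := lt_of_le_of_ne (not_lt.1 hcon) (mul_ne_zero hσ hi.1)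
  have hilt : i < I 0 := lt_of_le_of_ne hile fun e => by rw [← e] at h0; linarith
  have halt : Alternates u (p + 1) (-σ) := by
    refine ⟨Fin.cons i I, ?_, fun s => ?_⟩
    · rw [Fin.strictMono_iff_lt_succ]
      intro s
      rcases Fin.eq_zero_or_eq_succ s with rfl | ⟨t, rfl⟩
      · simpa using hilt
      · rw [← Fin.succ_castSucc]
        simpa using hI t.castSucc_lt_succ
    · rcases Fin.eq_zero_or_eq_succ s with rfl | ⟨t, rfl⟩
      · simpa using hneg
      · have := h t
        rw [Fin.val_succ, pow_succ, Fin.cons_succ]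
        linarith
  have := halt.le_variation
  rw [hp, Nat.cast_le] at this
  omega

theorem exists_isFirstNonzero [WellFoundedLT ι] {u : ι → ℝ} (hu : ∃ i, u i ≠ 0) :
    ∃ i, IsFirstNonzero u i := by
  obtain ⟨i, hi, hmin⟩ := WellFounded.has_min (wellFounded_lt (α := ι)) {i | u i ≠ 0} hu
  exact ⟨i, hi, fun l hl => by_contra fun h => hmin l h hl⟩

theorem sign_eq_of_mul_pos {x y : ℝ} (h : 0 < x * y) : SignType.sign x = SignType.sign y := by
  rcases pos_and_pos_or_neg_and_neg_of_mul_pos h with ⟨h1, h2⟩ | ⟨h1, h2⟩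
  · rw [sign_pos h1, sign_pos h2]
  · rw [sign_neg h1, sign_neg h2]

theorem mul_pos_of_sign_eq {x y : ℝ} (hx : x ≠ 0) (h : SignType.sign x = SignType.sign y) :
    0 < x * y := by
  rcases lt_or_gt_of_ne hx with h1 | h1
  · rw [sign_neg h1] at h
    exact mul_pos_of_neg_of_neg h1 (sign_eq_neg_one_iff.1 h.symm)
  · rw [sign_pos h1] at h
    exact mul_pos h1 (sign_eq_one_iff.1 h.symm)

/-- Order-preserving variation diminution means that every alternating pattern of the image is
already present in the argument. -/
theorem isOVD_iff [LocallyFiniteOrder ι] [LocallyFiniteOrder κ] [WellFoundedLT ι]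
    [WellFoundedLT κ] {k : ℕ} {D : Set (ι → ℝ)} {X : (ι → ℝ) → κ → ℝ} (hX : X 0 = 0) :
    IsOVD k D X ↔ ∀ u ∈ D, variation u ≤ k → ∀ p σ, Alternates (X u) p σ → Alternates u p σ := by
  constructor
  · intro h u hu hk p σ hp
    obtain ⟨hle, hsg⟩ := h u hu hk
    have hσ : σ ≠ 0 := by
      obtain ⟨I, -, h⟩ := hp
      rintro rfl
      simpa using h 0
    have hpu : (p : ℕ∞) ≤ variation u := hp.le_variation.trans hle
    rcases hpu.lt_or_eq with hlt | heq
    · obtain ⟨τ, -, hτ⟩ := exists_alternates_of_lt_variation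
        (u := u) (p := p) (by simpa using Order.add_one_le_of_lt hlt)
      exact hτ.of_lt (Nat.lt_succ_self p) hσ
    · have hXeq : variation (X u) = variation u :=
        le_antisymm hle (heq ▸ hp.le_variation)
      have hXne : ∃ i, X u i ≠ 0 := by
        obtain ⟨I, -, h⟩ := hp
        exact ⟨I 0, fun h0 => by simpa [h0] using h 0⟩
      -- This is where `X 0 = 0` enters: the definition puts no sign condition on a zero argument,
      -- so a pattern in its image must be ruled out separately.
      have hune : ∃ i, u i ≠ 0 := by
        by_contra hcon
        push Not at hcon
        have : u = 0 := funext hcon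
        subst this
        obtain ⟨i, hi⟩ := hXne
        exact hi (by rw [hX]; rfl)
      obtain ⟨i, hi⟩ := exists_isFirstNonzero hune
      obtain ⟨j, hj⟩ := exists_isFirstNonzero hXne
      have hsgn := hsg hXeq i j hi hj
      have hpos := hp.pos_first (hXeq.trans heq.symm) hj
      have hprod := mul_pos_of_sign_eq hi.1 hsgn
      have huiσ : 0 < u i * σ := by
        have := mul_pos hpos hprod
        nlinarith [mul_self_pos.2 hj.1]
      rcases Nat.eq_zero_or_pos p with rfl | hp0
      · exact alternates_zero_iff.2 ⟨i, by linarith⟩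
      · obtain ⟨p, rfl⟩ := Nat.exists_eq_succ_of_ne_zero hp0.ne'
        obtain ⟨τ, -, hτ⟩ := exists_alternates_of_lt_variation (u := u) (p := p) heq.le
        have hτi := hτ.pos_first heq.symm hi
        refine hτ.of_same_sign ?_
        have := mul_pos hτi huiσ
        nlinarith [mul_self_pos.2 hi.1]
  · intro h u hu hk
    have hfin : variation u ≠ ⊤ := ne_top_of_le_ne_top (ENat.natCast_ne_top k) hk
    obtain ⟨p, hp⟩ := ENat.ne_top_iff_exists.1 hfin
    refine ⟨?_, fun heq i j hi hj => ?_⟩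
    · by_contra hlt
      rw [not_le, ← hp] at hlt
      obtain ⟨σ, -, hσ⟩ := exists_alternates_of_lt_variation
        (u := X u) (p := p) (by simpa using Order.add_one_le_of_lt hlt)
      have := (h u hu hk _ _ hσ).le_variation
      rw [← hp, Nat.cast_le] at this
      omega
    · obtain ⟨σ, hσ⟩ : ∃ σ, Alternates (X u) p σ := by
        rcases Nat.eq_zero_or_pos p with rfl | hp0
        · exact ⟨X u j, alternates_zero_iff.2 ⟨j, mul_self_pos.2 hj.1⟩⟩
        · obtain ⟨p, rfl⟩ := Nat.exists_eq_succ_of_ne_zero hp0.ne'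
          obtain ⟨τ, -, hτ⟩ := exists_alternates_of_lt_variation
            (u := X u) (p := p) (by rw [heq, ← hp])
          exact ⟨τ, hτ⟩
      have h1 := hσ.pos_first (heq.trans hp.symm) hj
      have h2 := (h u hu hk _ _ hσ).pos_first hp.symm hi
      refine sign_eq_of_mul_pos ?_
      have := mul_pos h1 h2
      have hσ0 : σ ≠ 0 := left_ne_zero_of_mul h1.ne'
      nlinarith [mul_self_pos.2 hσ0]

end Patterns

/-! ### Variation diminution is equivalent to nonnegativity of minors. -/

section TotalNonnegativity

variable {ι κ : Type*} [LinearOrder ι] [LinearOrder κ]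

/-- All minors of order at most `k` of the (possibly infinite) matrix `X` are nonnegative. -/
def IsTotallyNonneg (k : ℕ) (X : Matrix κ ι ℝ) : Prop :=
  ∀ r ≤ k, ∀ (I : Fin r → κ) (J : Fin r → ι), StrictMono I → StrictMono J →
    0 ≤ (X.submatrix I J).det

theorem IsTotallyNonneg.submatrix {ι' κ' : Type*} [LinearOrder ι'] [LinearOrder κ'] {k : ℕ}
    {X : Matrix κ ι ℝ} (hX : IsTotallyNonneg k X) {f : κ' → κ} {g : ι' → ι} (hf : StrictMono f)
    (hg : StrictMono g) : IsTotallyNonneg k (X.submatrix f g) := fun r hr I J hI hJ => by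
  rw [Matrix.submatrix_submatrix]
  exact hX r hr _ _ (hf.comp hI) (hg.comp hJ)

theorem IsTotallyNonneg.transpose {k : ℕ} {X : Matrix κ ι ℝ} (hX : IsTotallyNonneg k X) :
    IsTotallyNonneg k Xᵀ := fun r hr I J hI hJ => by
  rw [← Matrix.det_transpose, Matrix.transpose_submatrix, Matrix.transpose_transpose]
  exact hX r hr J I hJ hI

theorem isKPositive_iff_isTotallyNonneg {n m k : ℕ} {X : Matrix (Fin n) (Fin m) ℝ} :
    IsKPositive k X ↔ IsTotallyNonneg k X := by
  constructor
  · intro h r hr I J hI hJ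
    rcases Nat.eq_zero_or_pos r with rfl | hr0
    · simp
    · exact h r hr0 hr (OrderEmbedding.ofStrictMono I hI) (OrderEmbedding.ofStrictMono J hJ)
  · intro h r _ hr I J
    exact h r hr I J I.strictMono J.strictMono

/-- Subtracting a multiple of the kernel vector `h` kills one coordinate of `v` without changing its
image, so the corresponding column becomes superfluous. -/
theorem exists_submatrix_succAbove_mulVec_eq {α : Type*} {q : ℕ} {Y : Matrix α (Fin (q + 1)) ℝ}
    {h : Fin (q + 1) → ℝ} (hh : h ≠ 0) (hY : Y *ᵥ h = 0) (v : Fin (q + 1) → ℝ) :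
    ∃ (c : Fin (q + 1)) (v' : Fin q → ℝ), Y.submatrix id c.succAbove *ᵥ v' = Y *ᵥ v := by
  obtain ⟨c, hc⟩ := Function.ne_iff.1 hh
  set w := v - (v c / h c) • h with hw
  have hwc : w c = 0 := by
    have : h c ≠ 0 := hc
    simp [hw, this]
  have hYw : Y *ᵥ w = Y *ᵥ v := by
    rw [hw, Matrix.mulVec_sub, Matrix.mulVec_smul, hY, smul_zero, sub_zero]
  refine ⟨c, w ∘ c.succAbove, ?_⟩
  rw [← hYw]
  ext a
  simp [Matrix.mulVec, dotProduct, Fin.sum_univ_succAbove _ c, hwc]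

/-- If the upper square block is singular, one column and the last row can be discarded, and
induction applies. Otherwise append the image as an extra first column: the determinant is zero, but
its expansion along that column has terms of one sign, the last of them nonzero. -/
theorem not_alternating_mulVec : ∀ (q : ℕ) (Y : Matrix (Fin (q + 1)) (Fin q) ℝ),
    IsTotallyNonneg q Y → ∀ (v : Fin q → ℝ) (σ : ℝ),
      ¬ ∀ s : Fin (q + 1), 0 < σ * (-1) ^ (s : ℕ) * (Y *ᵥ v) s := by
  intro q
  induction q with
  | zero =>
    intro Y _ v σ h
    simpa [Matrix.mulVec, dotProduct] using h 0
  | succ q ih =>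
    intro Y hY v σ h
    by_cases hdet : (Y.submatrix Fin.castSucc id).det = 0
    · obtain ⟨x, hx, hx0⟩ := Matrix.exists_mulVec_eq_zero_iff.2 hdet
      obtain ⟨c, v', hv'⟩ := exists_submatrix_succAbove_mulVec_eq hx hx0 v
      refine ih ((Y.submatrix Fin.castSucc id).submatrix id c.succAbove) (fun r hr I J hI hJ => ?_)
        v' σ fun s => ?_
      · rw [Matrix.submatrix_submatrix, Matrix.submatrix_submatrix]
        exact hY r (by omega) _ _ ((Fin.strictMono_castSucc.comp strictMono_id).comp hI)
          (strictMono_id.comp ((Fin.strictMono_succAbove c).comp hJ))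
      · rw [hv']
        exact h s.castSucc
    · set w := Y *ᵥ v with hw
      set B : Matrix (Fin (q + 2)) (Fin (q + 2)) ℝ :=
        Matrix.of fun s => (Fin.cons (w s) (Y s) : Fin (q + 2) → ℝ) with hB
      have hB0 : B.det = 0 := by
        -- The first column is `Y v`, so `(-1, v)` lies in the kernel.
        refine Matrix.exists_mulVec_eq_zero_iff.1 ⟨Fin.cons (-1) v, fun hz => ?_, ?_⟩
        · simpa using congrFun hz 0
        · ext s
          simp [hB, Matrix.mulVec, dotProduct, Fin.sum_univ_succ, hw]
      have hsub : ∀ s : Fin (q + 2), B.submatrix s.succAbove Fin.succ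
          = Y.submatrix s.succAbove id := fun s => by
        ext a c; simp [hB]
      rw [Matrix.det_succ_column_zero] at hB0
      have hnn : ∀ s : Fin (q + 2), 0 ≤ (Y.submatrix s.succAbove id).det := fun s =>
        hY _ le_rfl _ _ (Fin.strictMono_succAbove s) strictMono_id
      have hpos : 0 < ∑ s : Fin (q + 2),
          σ * ((-1) ^ (s : ℕ) * B s 0 * (B.submatrix s.succAbove Fin.succ).det) := by
        refine Finset.sum_pos' (fun s _ => ?_) ⟨Fin.last _, Finset.mem_univ _, ?_⟩
        · rw [hsub]
          have := mul_nonneg (h s).le (hnn s)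
          simp only [hB, Matrix.of_apply, Fin.cons_zero]
          linarith
        · rw [hsub]
          have h1 := hnn (Fin.last _)
          rw [Fin.succAbove_last] at h1 ⊢
          have := mul_pos (h (Fin.last _)) (lt_of_le_of_ne h1 (Ne.symm hdet))
          simp only [hB, Matrix.of_apply, Fin.cons_zero]
          linarith
      rw [← Finset.mul_sum, hB0, mul_zero] at hpos
      exact lt_irrefl _ hpos

/-- Cramer's rule for the first coordinate, expanded along the replaced column. For an alternating
image and nonnegative minors all summands have the same sign, which ties the sign of `v 0` to that
of the determinant. -/
theorem det_mul_apply_zero {q : ℕ} (Y : Matrix (Fin (q + 1)) (Fin (q + 1)) ℝ)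
    (v : Fin (q + 1) → ℝ) :
    Y.det * v 0 = ∑ s : Fin (q + 1), (-1) ^ (s : ℕ) * (Y *ᵥ v) s *
      (Y.submatrix s.succAbove Fin.succ).det := by
  have h1 : Y.cramer (Y *ᵥ v) = Y.det • v := by
    rw [Matrix.cramer_eq_adjugate_mulVec, Matrix.mulVec_mulVec, Matrix.adjugate_mul,
      Matrix.smul_mulVec, Matrix.one_mulVec]
  have h2 := congrFun h1 0
  rw [Matrix.cramer_apply, Matrix.det_succ_column_zero] at h2
  rw [Pi.smul_apply, smul_eq_mul] at h2
  rw [← h2]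
  refine Finset.sum_congr rfl fun s _ => ?_
  rw [Matrix.updateCol_self]
  congr 2

theorem mul_pos_of_alternating_mulVec {q : ℕ} {Y : Matrix (Fin (q + 1)) (Fin (q + 1)) ℝ}
    (hY : IsTotallyNonneg (q + 1) Y) {v : Fin (q + 1) → ℝ} {σ τ : ℝ} (hv : 0 < τ * v 0)
    (h : ∀ s : Fin (q + 1), 0 < σ * (-1) ^ (s : ℕ) * (Y *ᵥ v) s) : 0 < σ * τ := by
  by_cases hdet : Y.det = 0
  · obtain ⟨x, hx, hx0⟩ := Matrix.exists_mulVec_eq_zero_iff.2 hdet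
    obtain ⟨c, v', hv'⟩ := exists_submatrix_succAbove_mulVec_eq hx hx0 v
    refine absurd (fun s => ?_) (not_alternating_mulVec q (Y.submatrix id c.succAbove)
      (fun r hr I J hI hJ => ?_) v' σ)
    · rw [hv']; exact h s
    · rw [Matrix.submatrix_submatrix]
      exact hY r (by omega) _ _ hI ((Fin.strictMono_succAbove c).comp hJ)
  · have hdet' : 0 < Y.det := lt_of_le_of_ne
      (by simpa using hY (q + 1) le_rfl id id strictMono_id strictMono_id) (Ne.symm hdet)
    have h1 : 0 ≤ σ * (Y.det * v 0) := by
      rw [det_mul_apply_zero, Finset.mul_sum]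
      refine Finset.sum_nonneg fun s _ => ?_
      have := mul_nonneg (h s).le
        (hY q (Nat.le_succ q) _ _ (Fin.strictMono_succAbove s) Fin.strictMono_succ)
      linarith
    have hσ : σ ≠ 0 := by
      rintro rfl
      simpa using h 0
    have h2 : 0 ≤ σ * v 0 := by
      refine nonneg_of_mul_nonneg_right (a := Y.det) ?_ hdet'
      linarith
    have hv0 : v 0 ≠ 0 := right_ne_zero_of_mul hv.ne'
    have h3 : 0 < σ * v 0 := lt_of_le_of_ne h2 (mul_ne_zero hσ hv0).symm
    have := mul_pos h3 hv
    nlinarith [mul_self_pos.2 hv0]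

/-- Multilinearity in the columns. Disjoint blocks as index sets give the merging of columns below;
full index sets give Cauchy–Binet. -/
theorem det_sum_columns {r : ℕ} {α : Type*} (A : Fin r → Finset α)
    (X : Matrix (Fin r) α ℝ) (W : α → Fin r → ℝ) :
    (Matrix.of fun a l => ∑ i ∈ A l, X a i * W i l).det =
      ∑ f ∈ Fintype.piFinset A, (∏ l, W (f l) l) * (X.submatrix id f).det := by
  classical
  rw [← Matrix.det_transpose]
  have h1 : (Matrix.of fun a l => ∑ i ∈ A l, X a i * W i l)ᵀ =
      fun l => ∑ i ∈ A l, W i l • fun a => X a i := by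
    ext l a
    simp [Finset.sum_apply, mul_comm]
  rw [h1]
  have h2 := (Matrix.detRowAlternating (R := ℝ) (n := Fin r)).toMultilinearMap.map_sum_finset
    (fun l i => W i l • fun a => X a i) A
  refine h2.trans (Finset.sum_congr rfl fun f _ => ?_)
  rw [MultilinearMap.map_smul_univ, smul_eq_mul, ← Matrix.det_transpose]
  rfl

/-- Monotonicity of `blk` makes every choice of one column per block increasing, so each minor is a
nonnegative combination of minors of `X`. -/
theorem IsTotallyNonneg.sum_columns {k q : ℕ} {X : Matrix κ ι ℝ} (hX : IsTotallyNonneg k X)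
    {s : Finset ι} {blk : ι → ℕ} (hmono : MonotoneOn blk s) {w : ι → ℝ} (hw : ∀ i, 0 ≤ w i) :
    IsTotallyNonneg k (Matrix.of fun (a : κ) (l : Fin q) =>
      ∑ i ∈ s.filter (fun i => blk i = l), X a i * w i) := by
  intro r hr I J hI hJ
  have := det_sum_columns (fun l : Fin r => s.filter (fun i => blk i = J l)) (X.submatrix I id)
    (fun i _ => w i)
  refine le_of_le_of_eq (Finset.sum_nonneg fun f hf => ?_) this.symm
  refine mul_nonneg (Finset.prod_nonneg fun _ _ => hw _) ?_
  rw [Matrix.submatrix_submatrix]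
  simp only [Fintype.mem_piFinset, Finset.mem_filter] at hf
  refine hX r hr _ _ hI fun a b hab => ?_
  by_contra hle
  have h1 := hmono (hf b).1 (hf a).1 (not_lt.1 hle)
  rw [(hf a).2, (hf b).2] at h1
  exact absurd (hJ hab) (not_lt.2 h1)

/-- A totally nonnegative matrix of order `k` does not create alternating patterns. -/
theorem IsTotallyNonneg.alternates {k : ℕ} {X : Matrix κ ι ℝ} (hX : IsTotallyNonneg k X)
    {u : ι → ℝ} (hu : ∀ q σ, Alternates u q σ → q < k) (s : Finset ι) {p : ℕ} {σ : ℝ}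
    (h : Alternates (fun a => ∑ i ∈ s, X a i * u i) p σ) : Alternates u p σ := by
  classical
  have hfilter : (fun a => ∑ i ∈ s, X a i * u i) =
      fun a => ∑ i ∈ s.filter (fun i => u i ≠ 0), X a i * u i := by
    ext a
    rw [Finset.sum_filter_of_ne]
    exact fun i _ hi => right_ne_zero_of_mul hi
  rw [hfilter] at h
  obtain ⟨I, hI, hsI⟩ := h
  set S := s.filter (fun i => u i ≠ 0) with hS
  have hSne : S.Nonempty := by
    by_contra hcon
    rw [Finset.not_nonempty_iff_eq_empty] at hcon
    simpa [hcon] using hsI 0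
  obtain ⟨q, τ, blk, hτ, hmono, himg, hsgn⟩ := exists_sign_blocks u S hSne
    (fun i hi => (Finset.mem_filter.1 hi).2)
  have hqalt := alternates_of_sign_blocks hmono himg hsgn
  have hqk := hu _ _ hqalt
  -- Each sign block of `u` is merged into one column weighted by `|u i|`. The product becomes `Y v`
  -- with `v` an alternating vector of signs, and `q < k` ensures that minors of `Y` of every order
  -- are controlled.
  set Y : Matrix κ (Fin (q + 1)) ℝ := Matrix.of fun a l =>
      ∑ i ∈ S.filter (fun i => blk i = l), X a i * |u i| with hYdef
  have hY : IsTotallyNonneg k Y := hX.sum_columns hmono (fun i => abs_nonneg _)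
  set v : Fin (q + 1) → ℝ := fun l => τ * (-1) ^ (l : ℕ) with hv
  have hYv : ∀ a, (Y *ᵥ v) a = ∑ i ∈ S, X a i * u i := by
    intro a
    simp only [Matrix.mulVec, dotProduct, hYdef, Matrix.of_apply, Finset.sum_filter,
      Finset.sum_mul]
    rw [Finset.sum_comm]
    refine Finset.sum_congr rfl fun i hi => ?_
    have hlt : blk i < q + 1 := by
      have := Finset.mem_image_of_mem blk hi
      rwa [himg, Finset.mem_range] at this
    rw [Finset.sum_eq_single (⟨blk i, hlt⟩ : Fin (q + 1))]
    · rw [if_pos rfl, mul_assoc]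
      congr 1
      have h1 := hsgn i hi
      have h2 : (τ * (-1) ^ blk i = 1) ∨ (τ * (-1) ^ blk i = -1) := by
        rcases neg_one_pow_eq_or ℝ (blk i) with h | h <;> rcases hτ with rfl | rfl <;> simp [h]
      simp only [hv]
      rcases h2 with h2 | h2 <;> rw [h2] at h1 ⊢
      · rw [abs_of_pos (by linarith)]; ring
      · rw [abs_of_neg (by linarith)]; ring
    · intro l _ hl
      rw [if_neg, zero_mul]
      exact fun e => hl (Fin.ext e.symm)
    · simp
  have hsY : ∀ t : Fin (p + 1), 0 < σ * (-1) ^ (t : ℕ) * (Y *ᵥ v) (I t) := fun t => by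
    rw [hYv]; exact hsI t
  have hσ : σ ≠ 0 := by
    rintro rfl
    simpa using hsI 0
  rcases lt_trichotomy p q with hpq | rfl | hpq
  · exact hqalt.of_lt hpq hσ
  · refine hqalt.of_same_sign ?_
    rw [mul_comm]
    refine mul_pos_of_alternating_mulVec (Y := Y.submatrix I id) (v := v) (fun r hr K L hK hL => ?_)
      ?_ hsY
    · exact hY.submatrix hI strictMono_id r (by omega) K L hK hL
    · rcases hτ with rfl | rfl <;> simp [hv]
  · have hle : q + 2 ≤ p + 1 := by omega
    refine absurd (fun t => ?_) (not_alternating_mulVec (q + 1)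
      (Y.submatrix (I ∘ Fin.castLE hle) id) (fun r hr K L hK hL => ?_) v σ)
    · exact hsY (Fin.castLE hle t)
    · exact hY.submatrix (hI.comp (Fin.strictMono_castLE hle)) strictMono_id r (by omega) K L hK hL

/-- A map that does not create alternating patterns is totally nonnegative. -/
theorem isTotallyNonneg_of_alternates {k : ℕ} {X : Matrix κ ι ℝ} {Φ : (ι → ℝ) → κ → ℝ}
    (hΦ : ∀ (u : ι → ℝ) (s : Finset ι), (∀ i ∉ s, u i = 0) → Φ u = fun a => ∑ i ∈ s, X a i * u i)
    (h : ∀ (u : ι → ℝ) (s : Finset ι), (∀ i ∉ s, u i = 0) →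
      (∀ q σ, Alternates u q σ → q < k) → ∀ p σ, Alternates (Φ u) p σ → Alternates u p σ) :
    IsTotallyNonneg k X := by
  classical
  intro r
  induction r with
  | zero => intro _ I J _ _; simp
  | succ r ih =>
    intro hr I J hI hJ
    have ih := ih (by omega)
    by_contra hneg
    rw [not_le] at hneg
    set B := X.submatrix I J with hB
    -- A negative minor is invertible, so some input supported on `J` has an alternating image on
    -- `I`. Variation diminution forces `v 0 > 0`, while Cramer's rule with the nonnegative
    -- lower-order minors forces `det B * v 0 ≥ 0`.
    set v : Fin (r + 1) → ℝ := B⁻¹ *ᵥ fun s => (-1) ^ (s : ℕ) with hv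
    have hBv : B *ᵥ v = fun s : Fin (r + 1) => (-1 : ℝ) ^ (s : ℕ) := by
      rw [hv, Matrix.mulVec_mulVec, Matrix.mul_nonsing_inv _ hneg.ne.isUnit, Matrix.one_mulVec]
    set u : ι → ℝ := Function.extend J v 0 with hu
    have huJ : ∀ l, u (J l) = v l := fun l => hJ.injective.extend_apply _ _ _
    have hu0 : ∀ i ∉ Finset.univ.image J, u i = 0 := fun i hi => by
      rw [hu, Function.extend_apply']
      · rfl
      · rintro ⟨l, rfl⟩
        exact hi (Finset.mem_image_of_mem _ (Finset.mem_univ _))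
    have hsupp : ∀ q (K : Fin q → ι), (∀ t, u (K t) ≠ 0) → ∀ t, K t ∈ Set.range J :=
      fun q K hK t => by
        by_contra hcon
        exact hK t (hu0 _ fun hm => hcon (by simpa using hm))
    have hlt : ∀ q σ, Alternates u q σ → q < k := by
      rintro q σ ⟨K, hK, hsK⟩
      have hne : ∀ t, u (K t) ≠ 0 := fun t => right_ne_zero_of_mul (hsK t).ne'
      have := Finset.card_le_card_of_injOn (s := Finset.univ) (t := Finset.univ.image J) K
        (fun t _ => by simpa using hsupp _ K hne t) hK.injective.injOn
      have h2 : (Finset.univ.image J).card ≤ r + 1 := by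
        simpa using Finset.card_image_le (s := Finset.univ) (f := J)
      simp only [Finset.card_univ, Fintype.card_fin] at this
      omega
    have hΦu : ∀ s, Φ u (I s) = (-1) ^ (s : ℕ) := fun s => by
      rw [hΦ u _ hu0, ← congrFun hBv s]
      simp only [Matrix.mulVec, dotProduct, hB, Matrix.submatrix_apply]
      rw [Finset.sum_image hJ.injective.injOn]
      simp only [huJ]
    have halt : Alternates (Φ u) r 1 := ⟨I, hI, fun s => by
      rw [hΦu, one_mul, ← mul_pow]; norm_num⟩
    obtain ⟨K, hK, hsK⟩ := h u _ hu0 hlt r 1 halt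
    have hne : ∀ t, u (K t) ≠ 0 := fun t => right_ne_zero_of_mul (hsK t).ne'
    -- The pattern needs `r + 1` nonzero entries and the support has at most that many positions, so
    -- the pattern starts at `J 0`.
    have hKJ : K = J := by
      refine (hK.range_inj hJ).1 ?_
      have hsub : Finset.univ.image K ⊆ Finset.univ.image J := fun x hx => by
        obtain ⟨t, -, rfl⟩ := Finset.mem_image.1 hx
        simpa using hsupp _ K hne t
      have heq := Finset.eq_of_subset_of_card_le hsub (by
        rw [Finset.card_image_of_injective _ hK.injective,
          Finset.card_image_of_injective _ hJ.injective])
      simpa using congrArg (fun S : Finset ι => (S : Set ι)) heq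
    have hv0 : 0 < v 0 := by
      have := hsK 0
      rw [hKJ, huJ] at this
      simpa using this
    have hsum : 0 ≤ B.det * v 0 := by
      rw [det_mul_apply_zero, hBv]
      refine Finset.sum_nonneg fun s _ => mul_nonneg ?_ ?_
      · rw [← mul_pow]; norm_num
      · rw [hB, Matrix.submatrix_submatrix]
        exact ih _ _ (hI.comp (Fin.strictMono_succAbove s)) (hJ.comp Fin.strictMono_succ)
    exact absurd hsum (not_le.2 (mul_neg_of_neg_of_pos hneg hv0))

theorem variation_le_iff [LocallyFiniteOrder ι] {k : ℕ} (hk : 1 ≤ k) {u : ι → ℝ} :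
    variation u ≤ ((k - 1 : ℕ) : ℕ∞) ↔ ∀ q σ, Alternates u q σ → q < k := by
  constructor
  · intro h q σ hq
    have := hq.le_variation.trans h
    rw [Nat.cast_le] at this
    omega
  · intro h
    by_contra hlt
    rw [not_le] at hlt
    obtain ⟨σ, -, hσ⟩ := exists_alternates_of_lt_variation (u := u) (p := k - 1)
      (by simpa using Order.add_one_le_of_lt hlt)
    have := h _ _ hσ
    omega

/-- A matrix with finitely many columns is order-preserving variation diminishing if and only if its
minors are nonnegative. -/
theorem isOVD_matrix_iff [LocallyFiniteOrder ι] [LocallyFiniteOrder κ] [WellFoundedLT ι]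
    [WellFoundedLT κ] [Fintype ι] {k : ℕ} (hk : 1 ≤ k) (X : Matrix κ ι ℝ) :
    IsOVD (k - 1) Set.univ (fun u => X *ᵥ u) ↔ IsTotallyNonneg k X := by
  rw [isOVD_iff (Matrix.mulVec_zero X)]
  constructor
  · intro h
    refine isTotallyNonneg_of_alternates (Φ := fun u => X *ᵥ u) (fun u s hs => ?_)
      fun u s _ hu => h u trivial ((variation_le_iff hk).2 hu)
    ext a
    refine (Finset.sum_subset (Finset.subset_univ s) fun i _ hi => ?_).symm
    rw [hs i hi, mul_zero]
  · intro h u _ hu p σ hp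
    exact h.alternates ((variation_le_iff hk).1 hu) Finset.univ hp

/-- Input sequences: the minors of the matrix with columns `x 0, x 1, …` govern the map
`u ↦ ∑ u i • x i` on bounded sequences. -/
theorem isOVD_tsum_iff [LocallyFiniteOrder κ] [WellFoundedLT κ] [Finite κ] {k : ℕ} (hk : 1 ≤ k)
    {x : ℕ → κ → ℝ} (hx : ∀ u : ℕ → ℝ, Memℓp u ∞ → Summable fun i => u i • x i) :
    IsOVD (k - 1) {u : ℕ → ℝ | Memℓp u ∞} (fun u => ∑' i, u i • x i) ↔
      IsTotallyNonneg k (Matrix.of fun a i => x i a) := by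
  classical
  have hfin : ∀ (u : ℕ → ℝ) (s : Finset ℕ), (∀ i ∉ s, u i = 0) →
      ∑' i, u i • x i = fun a => ∑ i ∈ s, (Matrix.of fun a i => x i a) a i * u i := by
    intro u s hs
    rw [tsum_eq_sum (s := s) fun i hi => by rw [hs i hi, zero_smul]]
    ext a
    simp [mul_comm]
  rw [isOVD_iff (by ext; simp)]
  constructor
  · intro h
    refine isTotallyNonneg_of_alternates hfin fun u s hs hu =>
      h u ?_ ((variation_le_iff hk).2 hu)
    refine (memℓp_infty_iff).2 ((s.finite_toSet.image (fun i => ‖u i‖)).union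
      (Set.finite_singleton 0) |>.bddAbove.mono ?_)
    rintro _ ⟨i, rfl⟩
    by_cases hi : i ∈ s
    · exact Or.inl ⟨i, hi, rfl⟩
    · exact Or.inr (by simp [hs i hi])
  · intro h u hu hvar p σ hp
    obtain ⟨I, hI, hsI⟩ := hp
    have hu' := (variation_le_iff hk).1 hvar
    have hlim := (hx u hu).hasSum.tendsto_sum_nat
    -- A given alternating pattern is a finite system of strict inequalities, hence is already
    -- present in some partial sum.
    have hev : ∀ t : Fin (p + 1), ∀ᶠ N in Filter.atTop,
        0 < σ * (-1) ^ (t : ℕ) * (∑ i ∈ Finset.range N, u i • x i) (I t) := fun t =>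
      (((tendsto_pi_nhds.1 hlim (I t)).const_mul _).eventually_const_lt (hsI t))
    obtain ⟨N, hN⟩ := (Filter.eventually_all.2 hev).exists
    refine h.alternates hu' (Finset.range N) ⟨I, hI, fun t => ?_⟩
    have := hN t
    simpa [mul_comm, Finset.sum_apply] using this

end TotalNonnegativity

/-! ### Cauchy–Binet, compound matrices and dual cones. -/

section CauchyBinet

/-- The Cauchy–Binet formula. -/
theorem det_mul_eq_sum {r n : ℕ} (X : Matrix (Fin r) (Fin n) ℝ) (Y : Matrix (Fin n) (Fin r) ℝ) :
    (X * Y).det = ∑ J : Fin r ↪o Fin n, (X.submatrix id J).det * (Y.submatrix J id).det := by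
  classical
  have h1 := det_sum_columns (fun _ : Fin r => (Finset.univ : Finset (Fin n))) X Y
  have h2 : (Matrix.of fun a l => ∑ i ∈ (Finset.univ : Finset (Fin n)), X a i * Y i l) = X * Y := by
    ext a l; rfl
  rw [h2, Fintype.piFinset_univ] at h1
  rw [h1]
  -- Injective index choices are exactly an increasing choice followed by a permutation; the others
  -- repeat a column and contribute zero.
  set e : (Fin r ↪o Fin n) × Equiv.Perm (Fin r) → (Fin r → Fin n) := fun P => P.1 ∘ P.2 with he
  have hinj : Function.Injective e := by
    rintro ⟨J, σ⟩ ⟨J', σ'⟩ h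
    have h : ⇑J ∘ σ = ⇑J' ∘ σ' := h
    have hJ : J = J' := by
      rw [← OrderEmbedding.range_inj, ← σ.surjective.range_comp J, h, σ'.surjective.range_comp]
    subst hJ
    refine Prod.ext rfl (Equiv.ext fun x => J.injective (congrFun h x))
  rw [← Fintype.sum_of_injective e hinj
    (fun P => (∏ l, Y (e P l) l) * (X.submatrix id (e P)).det) _ ?_ fun _ => rfl]
  · rw [Fintype.sum_prod_type]
    refine Finset.sum_congr rfl fun J _ => ?_
    rw [Matrix.det_apply' (Y.submatrix J id), Finset.mul_sum]
    refine Finset.sum_congr rfl fun σ _ => ?_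
    have : (X.submatrix id (e (J, σ))).det = Equiv.Perm.sign σ * (X.submatrix id J).det := by
      rw [← Matrix.det_permute', Matrix.submatrix_submatrix]
      rfl
    rw [this]
    simp only [he, Function.comp_apply, Matrix.submatrix_apply, id]
    ring
  · intro f hf
    by_cases hfi : Function.Injective f
    · refine absurd ⟨(OrderEmbedding.ofStrictMono (f ∘ Tuple.sort f)
        ((Tuple.monotone_sort f).strictMono_of_injective
          (hfi.comp (Tuple.sort f).injective)), (Tuple.sort f)⁻¹), ?_⟩ hf
      ext x
      simp [he]
    · rw [Function.Injective] at hfi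
      push Not at hfi
      obtain ⟨a, b, hab, hne⟩ := hfi
      rw [Matrix.det_zero_of_column_eq hne (fun i => by simp [hab]), mul_zero]

theorem compound_mul {m n p : ℕ} (X : Matrix (Fin m) (Fin n) ℝ) (Y : Matrix (Fin n) (Fin p) ℝ)
    (r : ℕ) : compound (X * Y) r = compound X r * compound Y r := by
  ext I J
  rw [Matrix.mul_apply]
  exact det_mul_eq_sum (X.submatrix I id) (Y.submatrix id J)

theorem compound_one (n r : ℕ) : compound (1 : Matrix (Fin n) (Fin n) ℝ) r = 1 := by
  ext I J
  by_cases h : I = J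
  · subst h
    simp [compound, Matrix.submatrix_one I I.injective]
  · rw [Matrix.one_apply_ne h]
    obtain ⟨i, hi⟩ : ∃ i, I i ∉ Set.range J := by
      by_contra hcon
      push Not at hcon
      apply h
      rw [← OrderEmbedding.range_inj]
      have hsub : Finset.univ.image I ⊆ Finset.univ.image J := fun x hx => by
        obtain ⟨t, -, rfl⟩ := Finset.mem_image.1 hx
        simpa using hcon t
      have heq := Finset.eq_of_subset_of_card_le hsub (by
        rw [Finset.card_image_of_injective _ I.injective,
          Finset.card_image_of_injective _ J.injective])
      simpa using congrArg (fun S : Finset (Fin n) => (S : Set (Fin n))) heq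
    refine Matrix.det_eq_zero_of_row_eq_zero i fun j => ?_
    exact Matrix.one_apply_ne fun e => hi ⟨j, e.symm⟩

/-- A matrix with independent columns has a nonzero maximal minor. -/
theorem exists_det_submatrix_ne_zero {n r : ℕ} {Y : Matrix (Fin n) (Fin r) ℝ}
    (hY : ∀ x, Y *ᵥ x = 0 → x = 0) : ∃ J : Fin r ↪o Fin n, (Y.submatrix J id).det ≠ 0 := by
  by_contra hcon
  push Not at hcon
  -- The Gram determinant is the sum of the squares of the maximal minors.
  have h0 : (Yᵀ * Y).det = 0 := by
    rw [det_mul_eq_sum]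
    exact Finset.sum_eq_zero fun J _ => by rw [hcon J, mul_zero]
  obtain ⟨x, hx, hx0⟩ := Matrix.exists_mulVec_eq_zero_iff.2 h0
  refine hx (hY x ?_)
  rw [← dotProduct_self_eq_zero, Matrix.dotProduct_mulVec, Matrix.vecMul_mulVec,
    ← Matrix.mulVec_transpose, Matrix.transpose_mul, Matrix.transpose_transpose, hx0, zero_dotProduct]

theorem mem_dualCone_cone_iff {ι κ : Type*} [Fintype ι] [Fintype κ] {P : Matrix ι κ ℝ}
    {y : ι → ℝ} : y ∈ dualCone (cone P) ↔ ∀ j, 0 ≤ (y ᵥ* P) j := by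
  classical
  constructor
  · intro h j
    have := h (P *ᵥ Pi.single j 1) ⟨_, fun i => ?_, rfl⟩
    · rw [Matrix.dotProduct_mulVec] at this
      simpa using this
    · exact (Pi.single_nonneg.2 zero_le_one : (0 : κ → ℝ) ≤ Pi.single j (1 : ℝ)) i
  · rintro h _ ⟨x, hx, rfl⟩
    rw [Matrix.dotProduct_mulVec]
    exact Finset.sum_nonneg fun i _ => mul_nonneg (h i) (hx i)

end CauchyBinet

/-! ### Fekete's criterion and a totally positive approximation of the identity. -/

section ConsecutiveColumns

/-- A three-term relation between maximal minors of a matrix with one extra column `c` and maximal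
minors of the same matrix with its first row and one more column deleted. -/
theorem det_three_term {q : ℕ} (Z : Matrix (Fin (q + 2)) (Fin (q + 3)) ℝ) (s : Fin (q + 1)) :
    (Z.submatrix id s.castSucc.succ.succAbove).det *
        (Z.submatrix Fin.succ (fun i => i.castSucc.succ)).det =
      (Z.submatrix id Fin.succ).det *
          (Z.submatrix Fin.succ (fun i => s.castSucc.succ.succAbove i.castSucc)).det +
        (Z.submatrix id Fin.castSucc).det *
          (Z.submatrix Fin.succ (fun i => s.castSucc.succ.succAbove i.succ)).det := by
  set rest : Fin q → Fin (q + 3) := fun i => (s.succAbove i).castSucc.succ with hrest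
  set R : Fin (q + 1) → ℝ := fun l => (Z.submatrix (Fin.succ ∘ l.succAbove) rest).det with hR
  -- `v i` is the minor on all rows but the first with columns `i, rest`, expanded along column `i`.
  -- It is a combination of rows of `Z` and vanishes on the columns of `rest`.
  set v : Fin (q + 3) → ℝ := fun i => ∑ l : Fin (q + 1), (-1) ^ (l : ℕ) * Z l.succ i * R l with hv
  -- The signed maximal minors of `Z` annihilate every row of `Z`, hence also `v`. Only the first,
  -- the last and the distinguished column survive in this sum.
  have hsum : ∑ i : Fin (q + 3), (-1) ^ (i : ℕ) * v i * (Z.submatrix id i.succAbove).det = 0 := by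
    have hrow : ∀ l : Fin (q + 1), ∑ i : Fin (q + 3),
        (-1) ^ (i : ℕ) * Z l.succ i * (Z.submatrix id i.succAbove).det = 0 := fun l => by
      set B : Matrix (Fin (q + 3)) (Fin (q + 3)) ℝ :=
        Matrix.of (Fin.cons (Z l.succ) fun a => Z a) with hB
      have hB0 : B.det = 0 :=
        Matrix.det_zero_of_row_eq (i := 0) (j := l.succ.succ) (Fin.succ_ne_zero _).symm
          (by ext; simp [hB])
      rw [Matrix.det_succ_row_zero] at hB0
      rw [← hB0]
      rfl
    calc _ = ∑ l : Fin (q + 1), (-1) ^ (l : ℕ) * R l * ∑ i : Fin (q + 3),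
        (-1) ^ (i : ℕ) * Z l.succ i * (Z.submatrix id i.succAbove).det := by
          simp only [hv, Finset.mul_sum, Finset.sum_mul]
          rw [Finset.sum_comm]
          refine Finset.sum_congr rfl fun l _ => Finset.sum_congr rfl fun i _ => ?_
          ring
      _ = 0 := by simp only [hrow, mul_zero, Finset.sum_const_zero]
  have hvcol : ∀ (C : Fin (q + 1) → Fin (q + 3)) (j : Fin (q + 1)),
      (∀ i, C (j.succAbove i) = rest i) →
        (Z.submatrix Fin.succ C).det = (-1) ^ (j : ℕ) * v (C j) := fun C j hC => by
    rw [Matrix.det_succ_column _ j, hv, Finset.mul_sum]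
    refine Finset.sum_congr rfl fun l _ => ?_
    have : ((Z.submatrix Fin.succ C).submatrix l.succAbove j.succAbove) =
        Z.submatrix (Fin.succ ∘ l.succAbove) rest := by
      ext a b
      simp [hC]
    rw [this, pow_add]
    simp only [hR, Matrix.submatrix_apply]
    ring
  have hvrest : ∀ i, v (rest i) = 0 := fun i => by
    have := hvcol (Fin.cons (rest i) rest) 0 (fun i => by simp)
    rw [Matrix.det_zero_of_column_eq (i := 0) (j := i.succ) (Fin.succ_ne_zero _).symm
      (by intro; simp)] at this
    simpa using this.symm
  have hsucc : ∀ i : Fin (q + 1), s.castSucc.succ.succAbove i.succ = (s.castSucc.succAbove i).succ :=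
    fun i => by rw [Fin.succ_succAbove_succ]
  have e1 := hvcol (fun i => i.castSucc.succ) s (fun i => rfl)
  have e2 := hvcol (fun i => s.castSucc.succ.succAbove i.castSucc) 0 (fun i => by
    rw [Fin.succAbove_zero, Fin.castSucc_succ, hsucc, Fin.castSucc_succAbove_castSucc])
  have e3 := hvcol (fun i => s.castSucc.succ.succAbove i.succ) (Fin.last q) (fun i => by
    rw [Fin.succAbove_last, hsucc, Fin.castSucc_succAbove_castSucc])
  have hlast : s.castSucc.succ.succAbove (Fin.last q).succ = Fin.last (q + 2) := by
    rw [Fin.succ_last]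
    refine Fin.succAbove_ne_last_last fun h => ?_
    have h1 := s.2
    have h2 := congrArg Fin.val h
    simp at h2
    omega
  have hzero : s.castSucc.succ.succAbove (Fin.castSucc (0 : Fin (q + 1))) = 0 := by
    simp
  rw [e1, e2, e3]
  simp only [hlast, hzero]
  rw [Fin.sum_univ_succ, Fin.sum_univ_castSucc, Fin.sum_univ_succAbove _ s] at hsum
  have hz : ∀ i : Fin q, v ((s.succAbove i).castSucc.succ) = 0 := hvrest
  simp only [hz, mul_zero, zero_mul, Finset.sum_const_zero, add_zero, Fin.val_zero, pow_zero,
    one_mul, Fin.succAbove_zero, Fin.succ_last, Fin.succAbove_last, Fin.val_last, Fin.val_succ,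
    Fin.val_castSucc] at hsum ⊢
  have hq : ((-1 : ℝ) ^ (q + 1 + 1)) = (-1) ^ q := by rw [pow_add, pow_add]; ring
  have hs : (-1 : ℝ) ^ ((s : ℕ) + 1) = -(-1) ^ (s : ℕ) := by rw [pow_succ]; ring
  rw [hq, hs] at hsum
  linarith

/-- Fekete's criterion. If minors of consecutive columns are positive (as long as the set of columns
is admissible) then so are all admissible minors. -/
theorem det_pos_of_consecutive {κ : Type*} [LinearOrder κ] {M : Matrix κ ℕ ℝ} {k : ℕ}
    {Good : ∀ {r : ℕ}, (Fin r → ℕ) → Prop}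
    (hmono : ∀ {r : ℕ} {T T' : Fin r → ℕ}, T ≤ T' → Good T' → Good T)
    (hcomp : ∀ {r r' : ℕ} {T : Fin r → ℕ} (f : Fin r' → Fin r), Function.Injective f → Good T →
      Good (T ∘ f))
    (hbad : ∀ r ≤ k, ∀ (I : Fin r → κ) (T : Fin r → ℕ), StrictMono I → StrictMono T → ¬ Good T →
      0 ≤ (M.submatrix I T).det)
    (hcons : ∀ r ≤ k, ∀ (I : Fin r → κ) (s : ℕ), StrictMono I → Good (fun i : Fin r => s + i) →
      0 < (M.submatrix I (fun i : Fin r => s + i)).det) :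
    ∀ r ≤ k, ∀ (I : Fin r → κ) (T : Fin r → ℕ), StrictMono I → StrictMono T → Good T →
      0 < (M.submatrix I T).det := by
  intro r
  induction r with
  | zero => intro _ I T _ _ _; simp
  | succ r ihr =>
    intro hr I T hI
    have ihr := ihr (by omega)
    -- Inner induction on the spread of the column set.
    obtain ⟨d, hd⟩ : ∃ d, T (Fin.last r) - T 0 = d := ⟨_, rfl⟩
    induction d using Nat.strong_induction_on generalizing T with
    | _ d ihd =>
    intro hT hgood
    by_cases hgap : ∀ i : Fin r, T i.succ = T i.castSucc + 1
    · have hTeq : T = fun i : Fin (r + 1) => T 0 + i := by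
        ext i
        induction i using Fin.induction with
        | zero => simp
        | succ i ih =>
          rw [hgap, ih, Fin.val_succ, Fin.val_castSucc]
          omega
      rw [hTeq] at hgood ⊢
      exact hcons _ hr I _ hI hgood
    · push Not at hgap
      obtain ⟨i, hi⟩ := hgap
      obtain ⟨q, rfl⟩ : ∃ q, r = q + 1 := ⟨r - 1, by have := i.2; omega⟩
      have hlt : T i.castSucc + 1 < T i.succ :=
        lt_of_le_of_ne (Nat.succ_le_of_lt (hT i.castSucc_lt_succ)) (Ne.symm hi)
      -- A column inserted into a gap of `T` makes the three-term relation applicable: dropping the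
      -- first or the last column of `c` gives a smaller spread, and the other minors have smaller
      -- order.
      set c : Fin (q + 3) → ℕ := i.castSucc.succ.insertNth (T i.castSucc + 1) T with hc
      have hcT : c ∘ i.castSucc.succ.succAbove = T := by
        ext j; simp [hc]
      have hcs : c i.castSucc.succ = T i.castSucc + 1 := by simp [hc]
      have hcmono : StrictMono c := by
        have hlow : ∀ j : Fin (q + 2), j.castSucc < i.castSucc.succ →
            c (i.castSucc.succ.succAbove j) < c i.castSucc.succ := fun j hj => by
          rw [hcs]
          refine lt_of_le_of_lt (le_of_eq (congrFun hcT j)) (Nat.lt_succ_of_le (hT.monotone ?_))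
          rw [Fin.lt_def] at hj
          rw [Fin.le_def]
          simp at hj ⊢
          omega
        have hhigh : ∀ j : Fin (q + 2), i.castSucc.succ ≤ j.castSucc →
            c i.castSucc.succ < c (i.castSucc.succ.succAbove j) := fun j hj => by
          rw [hcs]
          refine lt_of_lt_of_le hlt (le_trans (hT.monotone ?_) (le_of_eq (congrFun hcT j).symm))
          rw [Fin.le_def] at hj ⊢
          simpa using hj
        intro a b hab
        rcases Fin.eq_self_or_eq_succAbove i.castSucc.succ a with rfl | ⟨a', rfl⟩
        · rcases Fin.eq_self_or_eq_succAbove i.castSucc.succ b with rfl | ⟨b', rfl⟩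
          · exact absurd hab (lt_irrefl _)
          · exact hhigh b' (Fin.lt_succAbove_iff_le_castSucc _ _ |>.1 hab)
        · rcases Fin.eq_self_or_eq_succAbove i.castSucc.succ b with rfl | ⟨b', rfl⟩
          · exact hlow a' (Fin.succAbove_lt_iff_castSucc_lt _ _ |>.1 hab)
          · have := hT ((Fin.strictMono_succAbove _).lt_iff_lt.1 hab)
            rwa [← hcT] at this
      have hle : c ∘ Fin.castSucc ≤ T := fun j => by
        rw [← hcT]
        refine hcmono.monotone ?_
        rw [Fin.succAbove]
        split_ifs
        · exact le_rfl
        · exact Fin.castSucc_lt_succ.le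
      have hG : Good (c ∘ Fin.castSucc) := hmono hle hgood
      have h0 : 0 < i.castSucc.succ := Fin.succ_pos _
      have hl : i.castSucc.succ < Fin.last (q + 2) := by
        rw [Fin.lt_def]
        have := i.2
        simp
        omega
      have hT0 : T 0 = c 0 := by
        rw [← hcT, Function.comp_apply, Fin.succAbove_ne_zero_zero h0.ne']
      have hTl : T (Fin.last (q + 1)) = c (Fin.last (q + 2)) := by
        rw [← hcT, Function.comp_apply, Fin.succAbove_ne_last_last hl.ne]
      have hI' : StrictMono (I ∘ Fin.succ) := hI.comp Fin.strictMono_succ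
      have hcc : StrictMono fun j : Fin (q + 1) => c j.castSucc.succ :=
        hcmono.comp (Fin.strictMono_succ.comp Fin.strictMono_castSucc)
      have key := det_three_term (M.submatrix I c) i
      simp only [Matrix.submatrix_submatrix, Function.comp_id] at key
      rw [hcT] at key
      have hE0r : 0 < (M.submatrix (I ∘ Fin.succ) (c ∘ fun j => j.castSucc.succ)).det :=
        ihr _ _ hI' hcc
          (hcomp (T := c ∘ Fin.castSucc) Fin.succ (Fin.succ_injective _) hG)
      have hE0s : 0 < (M.submatrix (I ∘ Fin.succ)
          (c ∘ fun j => i.castSucc.succ.succAbove j.succ)).det := by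
        have : (c ∘ fun j : Fin (q + 1) => i.castSucc.succ.succAbove j.succ) = T ∘ Fin.succ := by
          rw [← hcT]; rfl
        rw [this]
        exact ihr _ _ hI' (hT.comp Fin.strictMono_succ)
          (hcomp Fin.succ (Fin.succ_injective _) hgood)
      have hEsr : 0 < (M.submatrix (I ∘ Fin.succ)
          (c ∘ fun j => i.castSucc.succ.succAbove j.castSucc)).det := by
        have : (c ∘ fun j : Fin (q + 1) => i.castSucc.succ.succAbove j.castSucc)
            = T ∘ Fin.castSucc := by
          rw [← hcT]; rfl
        rw [this]
        exact ihr _ _ hI' (hT.comp Fin.strictMono_castSucc)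
          (hcomp Fin.castSucc (Fin.castSucc_injective _) hgood)
      have hDr : 0 < (M.submatrix I (c ∘ Fin.castSucc)).det := by
        refine ihd _ ?_ (c ∘ Fin.castSucc) rfl (hcmono.comp Fin.strictMono_castSucc) hG
        have h1 : c (Fin.last (q + 1)).castSucc < c (Fin.last (q + 2)) :=
          hcmono (Fin.castSucc_lt_last _)
        have h2 : c 0 ≤ c (Fin.last (q + 1)).castSucc := hcmono.monotone (Fin.zero_le _)
        have h3 : (c ∘ Fin.castSucc) 0 = c 0 := rfl
        have h4 : (c ∘ Fin.castSucc) (Fin.last (q + 1)) = c (Fin.last (q + 1)).castSucc := rfl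
        rw [h3, h4, ← hd, hT0, hTl]
        omega
      -- Dropping the first column may leave the admissible class, as exponents move up; a
      -- nonnegative value suffices here because the other product in the relation is strictly
      -- positive.
      have hD0 : 0 ≤ (M.submatrix I (c ∘ Fin.succ)).det := by
        by_cases hg : Good (c ∘ Fin.succ)
        · refine (ihd _ ?_ (c ∘ Fin.succ) rfl (hcmono.comp Fin.strictMono_succ) hg).le
          have h1 : c 0 < c (Fin.succ 0) := hcmono (Fin.succ_pos 0)
          have h2 : c (Fin.succ 0) ≤ c (Fin.last (q + 2)) := hcmono.monotone (Fin.le_last _)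
          have h3 : (c ∘ Fin.succ) 0 = c (Fin.succ 0) := rfl
          have h4 : (c ∘ Fin.succ) (Fin.last (q + 1)) = c (Fin.last (q + 2)) := rfl
          rw [h3, h4, ← hd, hT0, hTl]
          omega
        · exact hbad _ hr _ _ hI (hcmono.comp Fin.strictMono_succ) hg
      refine pos_of_mul_pos_left (b := (M.submatrix (I ∘ Fin.succ)
        (c ∘ fun j => j.castSucc.succ)).det) ?_ hE0r.le
      rw [key]
      exact add_pos_of_nonneg_of_pos (mul_nonneg hD0 hEsr.le) (mul_pos hDr hE0s)

/-- Positivity of generalized Vandermonde determinants. -/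
theorem det_pow_pos {κ : Type*} [LinearOrder κ] {x : κ → ℝ} (hx : StrictMono x)
    (hpos : ∀ i, 0 < x i) {r : ℕ} {I : Fin r → κ} {T : Fin r → ℕ} (hI : StrictMono I)
    (hT : StrictMono T) : 0 < (Matrix.of fun a b : Fin r => x (I a) ^ T b).det := by
  refine det_pos_of_consecutive (M := Matrix.of fun i t => x i ^ t) (k := r)
    (Good := fun {_} _ => True) (fun _ _ => trivial) (fun _ _ _ => trivial)
    (fun _ _ _ _ _ _ h => absurd trivial h) (fun r _ I s hI _ => ?_) r le_rfl I T hI hT trivial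
  have : (Matrix.of fun (i : κ) (t : ℕ) => x i ^ t).submatrix I (fun i : Fin r => s + i) =
      Matrix.of fun a b => x (I a) ^ s * Matrix.vandermonde (x ∘ I) a b := by
    ext a b
    simp [Matrix.vandermonde_apply, pow_add]
  rw [this, Matrix.det_mul_column, Matrix.det_vandermonde]
  refine mul_pos (Finset.prod_pos fun _ _ => pow_pos (hpos _) _)
    (Finset.prod_pos fun a _ => Finset.prod_pos fun b hb => ?_)
  exact sub_pos.2 (hx (hI (Finset.mem_Ioi.1 hb)))

/-- The matrix `q ^ (i - j)²`, close to the identity for small `q`. -/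
def gaussMatrix (n : ℕ) (q : ℝ) : Matrix (Fin n) (Fin n) ℝ :=
  Matrix.of fun i j => q ^ (((i : ℤ) - j).natAbs ^ 2)

theorem gaussMatrix_zero (n : ℕ) : gaussMatrix n 0 = 1 := by
  ext i j
  by_cases h : i = j
  · subst h
    simp [gaussMatrix]
  · rw [Matrix.one_apply_ne h, gaussMatrix, Matrix.of_apply, zero_pow]
    have : ((i : ℤ) - j) ≠ 0 := fun e => h (Fin.ext (by omega))
    simpa using this

theorem continuous_gaussMatrix (n : ℕ) : Continuous (gaussMatrix n) :=
  continuous_matrix fun _ _ => continuous_pow _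

theorem det_gaussMatrix_pos {n r : ℕ} {q : ℝ} (h0 : 0 < q) (h1 : q < 1) {I J : Fin r → Fin n}
    (hI : StrictMono I) (hJ : StrictMono J) : 0 < ((gaussMatrix n q).submatrix I J).det := by
  have hx : StrictMono fun i : Fin n => (q⁻¹ ^ 2) ^ (i : ℕ) := fun i j hij =>
    pow_lt_pow_right₀ (one_lt_pow₀ ((one_lt_inv₀ h0).2 h1) two_ne_zero) hij
  -- From `(i - j)² = i² + j² - 2ij`: up to positive row and column factors this is a generalized
  -- Vandermonde matrix with nodes `q^{-2i}`.
  have key : (gaussMatrix n q).submatrix I J = Matrix.of fun a b => q ^ ((I a : ℕ) ^ 2) *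
      (Matrix.of fun a b => q ^ ((J b : ℕ) ^ 2) *
        (Matrix.of fun a b : Fin r => ((q⁻¹ ^ 2) ^ (I a : ℕ)) ^ (J b : ℕ)) a b) a b := by
    ext a b
    simp only [gaussMatrix, Matrix.submatrix_apply, Matrix.of_apply]
    rw [← zpow_natCast, ← zpow_natCast q, ← zpow_natCast q, ← pow_mul, ← pow_mul, ← zpow_natCast,
      inv_zpow', ← zpow_add₀ h0.ne', ← zpow_add₀ h0.ne']
    congr 1
    push_cast
    rw [sq_abs]
    ring
  rw [key, Matrix.det_mul_column, Matrix.det_mul_row]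
  exact mul_pos (Finset.prod_pos fun _ _ => pow_pos h0 _)
    (mul_pos (Finset.prod_pos fun _ _ => pow_pos h0 _)
      (det_pow_pos hx (fun i => by positivity) hI (fun a b hab => hJ hab)))

end ConsecutiveColumns

/-! ### Nonnegativity of all minors of the controllability sequence. -/

section Controllability

theorem IsTotallyNonneg.mul {m n : ℕ} {κ : Type*} [LinearOrder κ] {k : ℕ}
    {X : Matrix (Fin m) (Fin n) ℝ} {Y : Matrix (Fin n) κ ℝ}
    (hX : IsTotallyNonneg k X) (hY : IsTotallyNonneg k Y) : IsTotallyNonneg k (X * Y) := by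
  intro r hr I J hI hJ
  have : (X * Y).submatrix I J = X.submatrix I id * Y.submatrix id J := rfl
  rw [this, det_mul_eq_sum]
  exact Finset.sum_nonneg fun L _ => mul_nonneg (hX r hr _ _ hI L.strictMono)
    (hY r hr _ _ L.strictMono hJ)

theorem IsTotallyNonneg.pow {n k : ℕ} {X : Matrix (Fin n) (Fin n) ℝ}
    (hX : IsTotallyNonneg k X) (s : ℕ) : IsTotallyNonneg k (X ^ s) := by
  induction s with
  | zero =>
    intro r _ I J hI hJ
    have h := congrFun (congrFun (compound_one n r) (OrderEmbedding.ofStrictMono I hI))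
      (OrderEmbedding.ofStrictMono J hJ)
    rw [pow_zero]
    refine le_of_le_of_eq ?_ h.symm
    rw [Matrix.one_apply]
    split_ifs <;> norm_num
  | succ s ih => rw [pow_succ]; exact ih.mul hX

/-- The kernels of the powers of an endomorphism grow by at least one dimension per step until they
stabilize. -/
theorem exists_stable_ker_pow {V : Type*} [AddCommGroup V] [Module ℝ V] [FiniteDimensional ℝ V]
    (f : Module.End ℝ V) : ∃ m, m ≤ Module.finrank ℝ (LinearMap.ker (f ^ m)) ∧
      ∀ s ≥ m, LinearMap.ker (f ^ s) = LinearMap.ker (f ^ m) := by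
  classical
  have hex : ∃ m, LinearMap.ker (f ^ m) = LinearMap.ker (f ^ m.succ) := by
    obtain ⟨m, -, hm⟩ := Module.End.exists_ker_pow_eq_ker_pow_succ f
    exact ⟨m, hm⟩
  have hle : ∀ s ≤ Nat.find hex, s ≤ Module.finrank ℝ (LinearMap.ker (f ^ s)) := by
    intro s
    induction s with
    | zero => simp
    | succ s ih =>
      intro hs
      have hlt : LinearMap.ker (f ^ s) < LinearMap.ker (f ^ (s + 1)) := by
        refine lt_of_le_of_ne (fun x hx => ?_) (Nat.find_min hex hs)
        rw [LinearMap.mem_ker] at hx ⊢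
        rw [pow_succ', Module.End.mul_apply, hx, map_zero]
      have := Submodule.finrank_lt_finrank_of_lt hlt
      have := ih (by omega)
      omega
  refine ⟨Nat.find hex, hle _ le_rfl, fun s hs => ?_⟩
  obtain ⟨t, rfl⟩ := Nat.exists_eq_add_of_le hs
  exact (Module.End.ker_pow_constant (Nat.find_spec hex) t).symm

variable {n : ℕ}

/-- The infinite matrix with columns `b, A b, A² b, …`. -/
def ctrbKernel (A : Matrix (Fin n) (Fin n) ℝ) (b : Fin n → ℝ) : Matrix (Fin n) ℕ ℝ :=
  Matrix.of fun i t => (A ^ t *ᵥ b) i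

theorem ctrbKernel_submatrix_mulVec (A : Matrix (Fin n) (Fin n) ℝ) (b : Fin n → ℝ) {r : ℕ}
    (T : Fin r → ℕ) (x : Fin r → ℝ) :
    (ctrbKernel A b).submatrix id T *ᵥ x = ∑ i, x i • (A ^ T i *ᵥ b) := by
  ext a
  simp [Matrix.mulVec, dotProduct, ctrbKernel, Finset.sum_apply, mul_comm]

theorem ctrbKernel_submatrix_add (A : Matrix (Fin n) (Fin n) ℝ) (b : Fin n → ℝ) (r s : ℕ) :
    (ctrbKernel A b).submatrix id (fun i : Fin r => s + i) = A ^ s * ctrbMatrix A b r := by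
  ext a i
  simp only [ctrbKernel, Matrix.submatrix_apply, Matrix.of_apply, id]
  rw [pow_add, ← Matrix.mulVec_mulVec]
  rfl

/-- All Cauchy–Binet summands are nonnegative, and independence of the columns of `Y` makes one of
them positive. -/
theorem det_pos_of_pos_mul {r : ℕ} {F : Matrix (Fin n) (Fin n) ℝ} {Y : Matrix (Fin n) (Fin r) ℝ}
    (hF : ∀ I J : Fin r → Fin n, StrictMono I → StrictMono J → 0 < (F.submatrix I J).det)
    (hY : ∀ J : Fin r → Fin n, StrictMono J → 0 ≤ (Y.submatrix J id).det)
    (hinj : ∀ x, Y *ᵥ x = 0 → x = 0) {I : Fin r → Fin n} (hI : StrictMono I) :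
    0 < ((F * Y).submatrix I id).det := by
  have : (F * Y).submatrix I id = F.submatrix I id * Y := rfl
  rw [this, det_mul_eq_sum]
  obtain ⟨J, hJ⟩ := exists_det_submatrix_ne_zero hinj
  refine Finset.sum_pos' (fun L _ => mul_nonneg (hF _ _ hI L.strictMono).le (hY L L.strictMono))
    ⟨J, Finset.mem_univ _, mul_pos (hF _ _ hI J.strictMono)
      (lt_of_le_of_ne (hY J J.strictMono) hJ.symm)⟩

/-- If more than `n - m` of the powers `A ^ T i` factor through `A ^ m`, of rank at most `n - m`,
then the vectors `A ^ T i b` are linearly dependent. -/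
theorem exists_ctrbKernel_relation {A : Matrix (Fin n) (Fin n) ℝ} {b : Fin n → ℝ} {m r : ℕ}
    (hm : m ≤ Module.finrank ℝ (LinearMap.ker (Matrix.toLin' A ^ m))) {T : Fin r → ℕ}
    (hT : n - m < (Finset.univ.filter fun i => m ≤ T i).card) :
    ∃ x, x ≠ 0 ∧ (ctrbKernel A b).submatrix id T *ᵥ x = 0 := by
  classical
  set f := Matrix.toLin' A with hf
  have hfpow : ∀ s v, (f ^ s) v = A ^ s *ᵥ v := fun s v => by
    rw [hf, ← Matrix.toLin'_pow, Matrix.toLin'_apply]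
  have hrk : Module.finrank ℝ (LinearMap.range (f ^ m)) ≤ n - m := by
    have := LinearMap.finrank_range_add_finrank_ker (f ^ m)
    rw [Module.finrank_fin_fun] at this
    omega
  let w : {i // m ≤ T i} → LinearMap.range (f ^ m) := fun i =>
    ⟨A ^ T i *ᵥ b, A ^ (T i - m) *ᵥ b, by
      rw [hfpow, Matrix.mulVec_mulVec, ← pow_add, Nat.add_sub_cancel' i.2]⟩
  have hdep : ¬ LinearIndependent ℝ w := fun hli => by
    have := hli.fintype_card_le_finrank
    rw [Fintype.card_subtype] at this
    omega
  obtain ⟨g, hg, i, hi⟩ := Fintype.not_linearIndependent_iff.1 hdep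
  refine ⟨fun i => if h : m ≤ T i then g ⟨i, h⟩ else 0, fun h0 => hi ?_, ?_⟩
  · have := congrFun h0 i
    simpa [i.2] using this
  · rw [ctrbKernel_submatrix_mulVec]
    have h2 := congrArg Subtype.val hg
    rw [Submodule.coe_sum] at h2
    refine Eq.trans ?_ h2
    symm
    refine Fintype.sum_of_injective Subtype.val Subtype.val_injective _ _ (fun j hj => ?_)
      fun j => ?_
    · rw [dif_neg, zero_smul]
      exact fun h => hj ⟨⟨j, h⟩, rfl⟩
    · simp [j.2, w]

/-- For `s + r ≤ n` the columns `A^s b, …, A^{s+r-1} b` are among the independent columns `b, …,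
A^{n-1} b`. -/
theorem ctrbMatrix_injective_of_le {A : Matrix (Fin n) (Fin n) ℝ} {b : Fin n → ℝ}
    (hctrb : ∀ x, ctrbMatrix A b n *ᵥ x = 0 → x = 0) {s r : ℕ} (h : s + r ≤ n) {x : Fin r → ℝ}
    (hx : (A ^ s * ctrbMatrix A b r) *ᵥ x = 0) : x = 0 := by
  let e : Fin r → Fin n := fun i => ⟨s + i, by omega⟩
  have he : Function.Injective e := fun i j hij => Fin.ext (by
    have := congrArg Fin.val hij
    simpa [e] using this)
  have hn : ctrbMatrix A b n = (ctrbKernel A b).submatrix id (fun i : Fin n => (i : ℕ)) := rfl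
  have h0 := hctrb (Function.extend e x 0) (by
    rw [← ctrbKernel_submatrix_add, ctrbKernel_submatrix_mulVec] at hx
    rw [hn, ctrbKernel_submatrix_mulVec]
    refine Eq.trans ?_ hx
    symm
    refine Fintype.sum_of_injective e he _ _ (fun j hj => ?_) fun i => ?_
    · rw [Function.extend_apply' _ _ _ (fun ⟨a, ha⟩ => hj ⟨a, ha⟩), Pi.zero_apply, zero_smul]
    · rw [he.extend_apply])
  ext i
  have := congrFun h0 (e i)
  rwa [he.extend_apply] at this

/-- If `A` is totally nonnegative of order `k`, the pair `(A, b)` is controllable and the maximal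
minors of `(b, A b, …, A^{j-1} b)` are nonnegative for `j ≤ k`, then the whole sequence
`b, A b, A² b, …` is totally nonnegative of order `k`. -/
theorem isTotallyNonneg_ctrbKernel {k : ℕ} {A : Matrix (Fin n) (Fin n) ℝ} {b : Fin n → ℝ}
    (hA : IsTotallyNonneg k A) (hctrb : ∀ x, ctrbMatrix A b n *ᵥ x = 0 → x = 0)
    (hb : ∀ j, 1 ≤ j → j ≤ k → ∀ I, 0 ≤ ctrbCompound A b j I) :
    IsTotallyNonneg k (ctrbKernel A b) := by
  obtain ⟨m, hm, hstab⟩ := exists_stable_ker_pow (Matrix.toLin' A)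
  have hmn : m ≤ n := by
    refine hm.trans ((Submodule.finrank_le _).trans ?_)
    rw [Module.finrank_fin_fun]
  have hker : ∀ s ≥ m, ∀ v, A ^ s *ᵥ v = 0 → A ^ m *ᵥ v = 0 := fun s hs v hv => by
    have : v ∈ LinearMap.ker (Matrix.toLin' A ^ s) := by
      rwa [LinearMap.mem_ker, ← Matrix.toLin'_pow, Matrix.toLin'_apply]
    rw [hstab s hs, LinearMap.mem_ker, ← Matrix.toLin'_pow, Matrix.toLin'_apply] at this
    exact this
  have hb' : ∀ j ≤ k, ∀ L : Fin j → Fin n, StrictMono L →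
      0 ≤ ((ctrbMatrix A b j).submatrix L id).det := fun j hj L hL => by
    rcases Nat.eq_zero_or_pos j with rfl | hj0
    · simp
    · exact hb j hj0 hj (OrderEmbedding.ofStrictMono L hL)
  -- Since `A^m` has rank at most `n - m`, more exponents than that at or above `m` force dependent
  -- columns and a zero minor. The condition survives lowering exponents and passing to subfamilies,
  -- as Fekete's criterion requires.
  let Good : ∀ {r : ℕ}, (Fin r → ℕ) → Prop := fun {r} T =>
    (Finset.univ.filter fun i => m ≤ T i).card ≤ n - m
  have hpos : ∀ q : ℝ, 0 < q → q < 1 → ∀ r ≤ k, ∀ (I : Fin r → Fin n) (T : Fin r → ℕ),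
      StrictMono I → StrictMono T →
        0 ≤ ((gaussMatrix n q * ctrbKernel A b).submatrix I T).det := by
    intro q h0 h1
    have hbad : ∀ r ≤ k, ∀ (I : Fin r → Fin n) (T : Fin r → ℕ), StrictMono I → StrictMono T →
        ¬ Good T → 0 ≤ ((gaussMatrix n q * ctrbKernel A b).submatrix I T).det := by
      intro r _ I T _ _ hT
      obtain ⟨x, hx, hx0⟩ := exists_ctrbKernel_relation (b := b) hm (not_le.1 hT)
      refine (Matrix.exists_mulVec_eq_zero_iff.1 ⟨x, hx, ?_⟩).ge
      have : (gaussMatrix n q * ctrbKernel A b).submatrix I T =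
          (gaussMatrix n q).submatrix I id * (ctrbKernel A b).submatrix id T := rfl
      rw [this, ← Matrix.mulVec_mulVec, hx0, Matrix.mulVec_zero]
    have hgood := det_pos_of_consecutive (M := gaussMatrix n q * ctrbKernel A b) (k := k)
      (Good := Good) (fun hTT' h => (Finset.card_le_card fun i hi => by
        simp only [Finset.mem_filter, Finset.mem_univ, true_and] at hi ⊢
        exact hi.trans (hTT' i)).trans h)
      (fun f hf h => (Finset.card_le_card_of_injOn f (fun i hi => by
        simpa using hi) hf.injOn).trans h) hbad (by
      intro r hr I s hI hs
      have hfac : (gaussMatrix n q * ctrbKernel A b).submatrix I (fun i : Fin r => s + i) =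
          (gaussMatrix n q * (A ^ s * ctrbMatrix A b r)).submatrix I id := by
        rw [← ctrbKernel_submatrix_add]; rfl
      rw [hfac]
      refine det_pos_of_pos_mul (fun I J hI hJ => det_gaussMatrix_pos h0 h1 hI hJ)
        (fun J hJ => ?_) (fun x hx => ?_) hI
      · have : (A ^ s * ctrbMatrix A b r).submatrix J id =
          (A ^ s).submatrix J id * ctrbMatrix A b r := rfl
        rw [this, det_mul_eq_sum]
        exact Finset.sum_nonneg fun L _ => mul_nonneg (hA.pow s r hr _ _ hJ L.strictMono)
          (hb' r hr L L.strictMono)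
      -- At most `m - s` (truncated) of the exponents lie below `m`. Hence `min s m + r ≤ n`; a
      -- start `s > m` may be replaced by `m`, because the kernels of the powers are constant from
      -- `m` on.
      · have hcount : r ≤ (n - m) + (m - s) := by
          have h2 := Finset.card_filter_add_card_filter_not (s := (Finset.univ : Finset (Fin r)))
            (fun i => m ≤ s + (i : ℕ))
          have h3 : (Finset.univ.filter fun i : Fin r => ¬ m ≤ s + (i : ℕ)).card ≤ m - s := by
            rw [← Finset.card_range (m - s)]
            refine Finset.card_le_card_of_injOn Fin.val (fun i hi => ?_) Fin.val_injective.injOn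
            simp at hi ⊢
            omega
          have h4 : (Finset.univ.filter fun i : Fin r => m ≤ s + (i : ℕ)).card ≤ n - m := hs
          rw [Finset.card_univ, Fintype.card_fin] at h2
          omega
        refine ctrbMatrix_injective_of_le hctrb (s := min s m) (by omega) ?_
        rcases le_total s m with hsm | hsm
        · rwa [min_eq_left hsm]
        · rw [min_eq_right hsm, ← Matrix.mulVec_mulVec]
          exact hker s hsm _ (by rwa [Matrix.mulVec_mulVec]))
    intro r hr I T hI hT
    by_cases hg : Good T
    · exact (hgood r hr I T hI hT hg).le
    · exact hbad r hr I T hI hT hg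
  intro r hr I T hI hT
  -- As `q → 0⁺` the smoothing matrix tends to the identity and nonnegativity passes to the limit.
  have hcont : Continuous fun q : ℝ => ((gaussMatrix n q * ctrbKernel A b).submatrix I T).det :=
    (((continuous_gaussMatrix n).matrix_mul continuous_const).matrix_submatrix I T).matrix_det
  have hlim := (hcont.tendsto 0).mono_left (nhdsWithin_le_nhds (s := Set.Ioi 0))
  rw [gaussMatrix_zero, Matrix.one_mul] at hlim
  refine ge_of_tendsto hlim ?_
  filter_upwards [Ioo_mem_nhdsGT (zero_lt_one' ℝ)] with q hq
  exact hpos q hq.1 hq.2 r hr I T hI hT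

end Controllability

/-! ### Stability, minimality and uniqueness of realizations. -/

section Realizations

open Polynomial

variable {n : ℕ}

/-! ### Summability of the controllability operator -/

section Summability

attribute [local instance] Matrix.linftyOpNormedRing Matrix.linftyOpNormedAlgebra

/-- Gelfand's formula, with `ρ` chosen between the spectral radius and `1`. -/
theorem exists_norm_pow_le {B : Matrix (Fin n) (Fin n) ℂ} (hn : 0 < n)
    (hB : ∀ z ∈ spectrum ℂ B, ‖z‖ < 1) :
    ∃ ρ : ℝ, 0 ≤ ρ ∧ ρ < 1 ∧ ∀ᶠ i : ℕ in Filter.atTop, ‖B ^ i‖ ≤ ρ ^ i := by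
  have : Nonempty (Fin n) := ⟨⟨0, hn⟩⟩
  have hρ : spectralRadius ℂ B < ((1 : NNReal) : ℝ≥0∞) :=
    spectrum.spectralRadius_lt_of_forall_lt B fun z hz => by
      rw [← NNReal.coe_lt_coe]
      simpa using hB z hz
  obtain ⟨ρ, h1, h2⟩ := ENNReal.lt_iff_exists_nnreal_btwn.1 hρ
  refine ⟨ρ, ρ.2, by exact_mod_cast h2, ?_⟩
  have hlim := spectrum.pow_nnnorm_pow_one_div_tendsto_nhds_spectralRadius B
  filter_upwards [hlim.eventually_lt_const h1, Filter.eventually_gt_atTop 0] with i hi hi0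
  have h3 : (‖B ^ i‖₊ : ℝ≥0∞) ≤ (ρ : ℝ≥0∞) ^ i := by
    have := ENNReal.rpow_le_rpow hi.le (Nat.cast_nonneg (α := ℝ) i)
    rwa [← ENNReal.rpow_mul, one_div, inv_mul_cancel₀ (Nat.cast_ne_zero.2 hi0.ne'),
      ENNReal.rpow_one, ENNReal.rpow_natCast] at this
  exact_mod_cast h3

theorem IsStable.summable {A : Matrix (Fin n) (Fin n) ℝ} (hA : IsStable A) (b : Fin n → ℝ)
    {u : ℕ → ℝ} (hu : Memℓp u ∞) : Summable fun i => u i • (A ^ i *ᵥ b) := by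
  rcases Nat.eq_zero_or_pos n with rfl | hn
  · exact (summable_zero).congr fun i => Subsingleton.elim _ _
  obtain ⟨ρ, h0, h1, hρ⟩ := exists_norm_pow_le hn hA
  obtain ⟨C, hC⟩ := memℓp_infty_iff.1 hu
  set b' : Fin n → ℂ := fun a => (b a : ℂ) with hb'
  have hcast : ∀ i a, (((A ^ i *ᵥ b) a : ℝ) : ℂ) =
      ((A.map (algebraMap ℝ ℂ)) ^ i *ᵥ b') a := fun i a => by
    rw [← Matrix.map_pow]
    simp [Matrix.mulVec, dotProduct, hb']
  refine Summable.of_norm_bounded_eventually_nat (g := fun i => C * (ρ ^ i * ‖b'‖))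
    (((summable_geometric_of_lt_one h0 h1).mul_right _).mul_left _) ?_
  filter_upwards [hρ] with i hi
  rw [norm_smul]
  have hCi : ‖u i‖ ≤ C := hC ⟨i, rfl⟩
  have hle : ‖A ^ i *ᵥ b‖ ≤ ρ ^ i * ‖b'‖ := by
    rw [pi_norm_le_iff_of_nonneg (mul_nonneg (pow_nonneg h0 i) (norm_nonneg b'))]
    intro a
    rw [← Complex.norm_real, hcast]
    have h1 := norm_le_pi_norm ((A.map (algebraMap ℝ ℂ)) ^ i *ᵥ b') a
    have h2 := Matrix.linfty_opNorm_mulVec ((A.map (algebraMap ℝ ℂ)) ^ i) b'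
    exact h1.trans (h2.trans (mul_le_mul_of_nonneg_right hi (norm_nonneg _)))
  exact mul_le_mul hCi hle (norm_nonneg _) ((norm_nonneg _).trans hCi)

end Summability

/-! ### Minimal realizations are controllable and observable -/

variable {G : RatFunc ℝ} {A : Matrix (Fin n) (Fin n) ℝ} {b c : Fin n → ℝ}

theorem IsMinimalRealization.natDegree_denom (h : IsMinimalRealization G A b c) :
    G.denom.natDegree = n := by
  have h1 := congrArg Multiset.card h.2
  rw [poles, ← (IsAlgClosed.splits _).natDegree_eq_card_roots,
    ← (IsAlgClosed.splits _).natDegree_eq_card_roots, Matrix.charpoly_natDegree_eq_dim,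
    Polynomial.natDegree_map, Fintype.card_fin] at h1
  exact h1.symm

/-- A root would be a pole, hence by minimality an eigenvalue of `A` outside the open unit disc. -/
theorem IsMinimalRealization.denom_eval_ne_zero (h : IsMinimalRealization G A b c) {x : ℝ}
    (hx : 1 ≤ x) : G.denom.eval x ≠ 0 := by
  intro h0
  have hmem : (x : ℂ) ∈ poles G := by
    rw [poles, mem_roots (Polynomial.map_ne_zero (RatFunc.denom_ne_zero G)), IsRoot.def, eval_map]
    have := Polynomial.hom_eval₂ G.denom (RingHom.id ℝ) (algebraMap ℝ ℂ) x
    rw [RingHom.comp_id] at this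
    have h2 : eval₂ (RingHom.id ℝ) x G.denom = 0 := h0
    rw [h2, map_zero] at this
    exact this.symm
  rw [← h.2, mem_roots (Matrix.charpoly_monic _).ne_zero,
    ← Matrix.mem_spectrum_iff_isRoot_charpoly] at hmem
  have := h.1.1 _ hmem
  rw [Complex.norm_real, Real.norm_eq_abs, abs_of_nonneg (by linarith)] at this
  linarith

theorem IsMinimalRealization.hasSum (h : IsMinimalRealization G A b c) {x : ℝ} (hx : 1 ≤ x) :
    HasSum (fun t => impulseResponse A b c t / x ^ t) (G.num.eval x / G.denom.eval x) := by
  have h1 := h.1.2 (x : ℂ) (by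
    rw [Complex.norm_real, Real.norm_eq_abs, abs_of_nonneg (by linarith)]; exact hx)
  have h2 : G.eval (algebraMap ℝ ℂ) x = ((G.num.eval x / G.denom.eval x : ℝ) : ℂ) := by
    rw [RatFunc.eval, Complex.ofReal_div]
    have := fun p : ℝ[X] => Polynomial.hom_eval₂ p (RingHom.id ℝ) (algebraMap ℝ ℂ) x
    simp only [RingHom.comp_id] at this
    exact congrArg₂ (· / ·) (this _).symm (this _).symm
  rw [h2] at h1
  refine Complex.hasSum_ofReal.1 ?_
  simpa using h1

/-- The impulse response of a minimal realization of order `n` satisfies no linear recurrence of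
order less than `n`. -/
theorem IsMinimalRealization.eq_zero_of_recurrence (h : IsMinimalRealization G A b c)
    {w : Fin n → ℝ} (hw : ∀ t, ∑ i : Fin n, w i * impulseResponse A b c (t + (i + 1)) = 0) :
    w = 0 := by
  set g := impulseResponse A b c with hg
  -- The recurrence kills all negative powers of `x` in `p(x) G(x)`, leaving the polynomial `q`. By
  -- coprimality the denominator, of degree `n`, divides `p`, of degree below `n`; so `p = 0`.
  set p : ℝ[X] := ∑ i : Fin n, C (w i) * X ^ (i : ℕ) with hp
  set q : ℝ[X] := ∑ i : Fin n, ∑ t ∈ Finset.range (i + 1), C (w i * g t) * X ^ ((i : ℕ) - t) with hq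
  have hev : ∀ x : ℝ, 1 ≤ x → (p * G.num).eval x = (q * G.denom).eval x := by
    intro x hx
    have hx0 : x ≠ 0 := by linarith
    have hS := h.hasSum hx
    set S := G.num.eval x / G.denom.eval x with hSdef
    have h1 : ∀ i : Fin n, HasSum (fun t => w i * g (t + (i + 1)) / x ^ (t + 1))
        (w i * (x ^ (i : ℕ) * S - ∑ t ∈ Finset.range (i + 1), g t * x ^ ((i : ℕ) - t))) := by
      intro i
      have h2 := (((hasSum_nat_add_iff' ((i : ℕ) + 1)).2 hS).mul_left (x ^ (i : ℕ))).mul_left (w i)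
      convert! h2 using 1
      · ext t
        rw [show t + ((i : ℕ) + 1) = (i : ℕ) + (t + 1) by ring, pow_add]
        field_simp
        ring
      · congr 1
        rw [mul_sub, Finset.mul_sum]
        congr 1
        refine Finset.sum_congr rfl fun t ht => ?_
        have hti : t ≤ i := by
          have := Finset.mem_range.1 ht
          omega
        have : x ^ (i : ℕ) = x ^ ((i : ℕ) - t) * x ^ t := by rw [← pow_add, Nat.sub_add_cancel hti]
        rw [this, hg]
        field_simp
    have h3 := hasSum_sum (s := Finset.univ) fun i _ => h1 i
    have h4 : (fun t => ∑ i : Fin n, w i * g (t + (i + 1)) / x ^ (t + 1)) = fun _ => 0 := by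
      ext t
      rw [← Finset.sum_div, hw, zero_div]
    rw [h4] at h3
    have h5 := h3.unique hasSum_zero
    have h6 : p.eval x * S = q.eval x := by
      rw [← sub_eq_zero, ← h5, hp, hq]
      simp only [eval_finsetSum, eval_mul, eval_C, eval_pow, eval_X, Finset.sum_mul, mul_sub,
        Finset.sum_sub_distrib, Finset.mul_sum, mul_assoc]
    rw [eval_mul, eval_mul, ← h6, hSdef, mul_assoc, div_mul_cancel₀ _ (h.denom_eval_ne_zero hx)]
  have heq : p * G.num = q * G.denom :=
    Polynomial.eq_of_infinite_eval_eq _ _ ((Set.Ici_infinite (1 : ℝ)).mono fun x hx => hev x hx)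
  have hdvd : G.denom ∣ p := (RatFunc.isCoprime_num_denom G).symm.dvd_of_dvd_mul_right
    (heq ▸ Dvd.intro_left q rfl)
  have hp0 : p = 0 := by
    refine Polynomial.eq_zero_of_dvd_of_degree_lt hdvd ?_
    rw [Polynomial.degree_eq_natDegree (RatFunc.denom_ne_zero G), h.natDegree_denom]
    exact Polynomial.degree_sum_fin_lt w
  ext i
  have := congrArg (fun p : ℝ[X] => p.coeff i) hp0
  simpa [hp, finsetSum_coeff, coeff_C_mul, coeff_X_pow, Fin.val_inj] using this

theorem impulseResponse_add_succ (A : Matrix (Fin n) (Fin n) ℝ) (b c : Fin n → ℝ) (s t : ℕ) :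
    impulseResponse A b c (s + (t + 1)) = (c ᵥ* A ^ s) ⬝ᵥ (A ^ t *ᵥ b) := by
  rw [← add_assoc, impulseResponse_succ, pow_add, ← Matrix.mulVec_mulVec, Matrix.dotProduct_mulVec]

theorem ctrbMatrix_mulVec (A : Matrix (Fin n) (Fin n) ℝ) (b : Fin n → ℝ) {r : ℕ} (x : Fin r → ℝ) :
    ctrbMatrix A b r *ᵥ x = ∑ i, x i • (A ^ (i : ℕ) *ᵥ b) :=
  ctrbKernel_submatrix_mulVec A b (fun i : Fin r => (i : ℕ)) x

theorem IsMinimalRealization.controllable (h : IsMinimalRealization G A b c) (x : Fin n → ℝ)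
    (hx : ctrbMatrix A b n *ᵥ x = 0) : x = 0 := by
  refine h.eq_zero_of_recurrence fun t => ?_
  rw [ctrbMatrix_mulVec] at hx
  have := congrArg (fun v => (c ᵥ* A ^ t) ⬝ᵥ v) hx
  simpa only [impulseResponse_add_succ, dotProduct_sum, dotProduct_smul, smul_eq_mul,
    dotProduct_zero] using this

theorem transpose_pow_mulVec (A : Matrix (Fin n) (Fin n) ℝ) (c : Fin n → ℝ) (i : ℕ) :
    Aᵀ ^ i *ᵥ c = c ᵥ* A ^ i := by
  rw [← Matrix.transpose_pow, Matrix.mulVec_transpose]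

theorem IsMinimalRealization.observable (h : IsMinimalRealization G A b c) (x : Fin n → ℝ)
    (hx : ctrbMatrix Aᵀ c n *ᵥ x = 0) : x = 0 := by
  refine h.eq_zero_of_recurrence fun t => ?_
  rw [ctrbMatrix_mulVec] at hx
  have := congrArg (fun v => v ⬝ᵥ (A ^ t *ᵥ b)) hx
  have hcomm : ∀ i : Fin n, impulseResponse A b c (t + ((i : ℕ) + 1)) =
      (c ᵥ* A ^ (i : ℕ)) ⬝ᵥ (A ^ t *ᵥ b) := fun i => by
    rw [← impulseResponse_add_succ]
    congr 1
    ring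
  simpa only [hcomm, transpose_pow_mulVec, sum_dotProduct, smul_dotProduct, smul_eq_mul,
    zero_dotProduct] using this

/-! ### Uniqueness of minimal realizations up to similarity -/

/-- Once the earlier coefficients vanish, multiplying by `x ^ t` isolates `h t` up to a tail of size
`K / x`; let `x → ∞`. Summability at `x = 1` makes `K` finite. -/
theorem eq_zero_of_hasSum_div_pow {h : ℕ → ℝ}
    (hh : ∀ x : ℝ, 1 ≤ x → HasSum (fun t => h t / x ^ t) 0) : h = 0 := by
  funext t
  induction t using Nat.strong_induction_on with
  | _ t ih =>
  have hsum : Summable fun s => ‖h s‖ := by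
    have := (hh 1 le_rfl).summable
    simpa using this.norm
  have hsum' : Summable fun s => ‖h (s + (t + 1))‖ := 
    (summable_nat_add_iff (f := fun s => ‖h s‖) (t + 1)).2 hsum
  set K := ∑' s, ‖h (s + (t + 1))‖ with hK
  have hbound : ∀ x : ℝ, 1 ≤ x → ‖h t‖ ≤ K / x := by
    intro x hx
    have hx0 : 0 < x := by linarith
    have h1 := ((hasSum_nat_add_iff' (t + 1)).2 (hh x hx)).mul_left (x ^ t)
    have h2 : ∑ s ∈ Finset.range (t + 1), h s / x ^ s = h t / x ^ t := by
      rw [Finset.sum_range_succ, Finset.sum_eq_zero, zero_add]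
      intro s hs
      rw [ih s (Finset.mem_range.1 hs)]
      simp
    rw [h2, zero_sub, mul_neg, mul_div_cancel₀ _ (pow_ne_zero t hx0.ne')] at h1
    have h3 : HasSum (fun s => ‖h (s + (t + 1))‖ / x) (K / x) := hsum'.hasSum.div_const x
    have h4 : ∀ s, ‖x ^ t * (h (s + (t + 1)) / x ^ (s + (t + 1)))‖ ≤ ‖h (s + (t + 1))‖ / x := by
      intro s
      have h5 : x ^ t * (h (s + (t + 1)) / x ^ (s + (t + 1))) = h (s + (t + 1)) / x ^ (s + 1) := by
        rw [show x ^ (s + (t + 1)) = x ^ t * x ^ (s + 1) by rw [← pow_add]; congr 1; omega]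
        field_simp
      rw [h5, norm_div, norm_pow, Real.norm_of_nonneg hx0.le]
      exact div_le_div_of_nonneg_left (norm_nonneg _) hx0 (le_self_pow₀ hx (Nat.succ_ne_zero s))
    rw [← norm_neg]
    exact h1.norm_le_of_bounded h3 h4
  have hlim : Filter.Tendsto (fun x : ℝ => K / x) Filter.atTop (nhds 0) :=
    Filter.Tendsto.div_atTop tendsto_const_nhds Filter.tendsto_id
  have := ge_of_tendsto hlim (Filter.eventually_atTop.2 ⟨1, hbound⟩)
  simpa using this

theorem IsMinimalRealization.impulseResponse_eq {m : ℕ} {A' : Matrix (Fin m) (Fin m) ℝ}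
    {b' c' : Fin m → ℝ} (h : IsMinimalRealization G A b c)
    (h' : IsMinimalRealization G A' b' c') :
    impulseResponse A b c = impulseResponse A' b' c' := by
  rw [← sub_eq_zero]
  refine eq_zero_of_hasSum_div_pow fun x hx => ?_
  have := (h.hasSum hx).sub (h'.hasSum hx)
  rw [sub_self] at this
  simpa only [Pi.sub_apply, sub_div] using this

theorem obsvMatrix_mul_apply (A : Matrix (Fin n) (Fin n) ℝ) (b c : Fin n → ℝ) (r s t : ℕ)
    (i : Fin r) (j : Fin s) : (obsvMatrix A c r * (A ^ t * ctrbMatrix A b s)) i j =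
      impulseResponse A b c ((i : ℕ) + ((t + j) + 1)) := by
  rw [impulseResponse_add_succ, ← ctrbKernel_submatrix_add, Matrix.mul_apply]
  simp only [obsvMatrix, ctrbMatrix, Matrix.transpose_apply, Matrix.of_apply, transpose_pow_mulVec]
  rfl

/-- Two minimal realizations of the same order are similar. -/
theorem IsMinimalRealization.exists_similarity {A' : Matrix (Fin n) (Fin n) ℝ} {b' c' : Fin n → ℝ}
    (h : IsMinimalRealization G A b c) (h' : IsMinimalRealization G A' b' c') :
    ∃ T : Matrix (Fin n) (Fin n) ℝ, IsUnit T.det ∧ A * T = T * A' ∧ T *ᵥ b' = b ∧ c ᵥ* T = c' := by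
  have hg := h.impulseResponse_eq h'
  have hunit : ∀ M : Matrix (Fin n) (Fin n) ℝ, (∀ x, M *ᵥ x = 0 → x = 0) → IsUnit M.det :=
    fun M hM => isUnit_iff_ne_zero.2 fun h0 => by
      obtain ⟨x, hx, hx0⟩ := Matrix.exists_mulVec_eq_zero_iff.2 h0
      exact hx (hM x hx0)
  set C := ctrbMatrix A b n
  set C' := ctrbMatrix A' b' n
  set O := obsvMatrix A c n with hO
  set O' := obsvMatrix A' c' n
  have hC : IsUnit C.det := hunit _ h.controllable
  have hC' : IsUnit C'.det := hunit _ h'.controllable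
  have hOu : IsUnit O.det := by
    rw [hO, obsvMatrix, Matrix.det_transpose]; exact hunit _ h.observable
  have hOC : ∀ t, O * (A ^ t * C) = O' * (A' ^ t * C') := fun t => by
    ext i j
    rw [obsvMatrix_mul_apply, obsvMatrix_mul_apply, hg]
  have hOC0 : O * C = O' * C' := by simpa using hOC 0
  have hOC1 : O * (A * C) = O' * (A' * C') := by simpa using hOC 1
  -- The only candidate, as a similarity must carry one controllability matrix to the other.
  -- Equality of the Hankel matrices gives `O T = O'`, and that of the shifted ones gives the
  -- intertwining relation after cancelling `O`.
  set T := C * C'⁻¹ with hT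
  have hTC : T * C' = C := by
    rw [hT, Matrix.mul_assoc, Matrix.nonsing_inv_mul _ hC', Matrix.mul_one]
  have hOT : O * T = O' := by
    rw [hT, ← Matrix.mul_assoc, hOC0, Matrix.mul_assoc, Matrix.mul_nonsing_inv _ hC',
      Matrix.mul_one]
  have hcancel : ∀ X Y : Matrix (Fin n) (Fin n) ℝ, O * X = O * Y → X = Y := fun X Y hXY => by
    rw [← Matrix.one_mul X, ← Matrix.one_mul Y, ← Matrix.nonsing_inv_mul _ hOu, Matrix.mul_assoc,
      Matrix.mul_assoc, hXY]
  refine ⟨T, ?_, ?_, ?_, ?_⟩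
  · rw [hT, Matrix.det_mul]
    exact hC.mul (Matrix.isUnit_nonsing_inv_det _ hC')
  · refine hcancel _ _ ?_
    rw [← Matrix.mul_assoc O T, hOT, hT, ← Matrix.mul_assoc A, ← Matrix.mul_assoc O, hOC1,
      ← Matrix.mul_assoc O', Matrix.mul_assoc (O' * A'), Matrix.mul_nonsing_inv _ hC',
      Matrix.mul_one]
  · rcases Nat.eq_zero_or_pos n with rfl | hn
    · exact Subsingleton.elim _ _
    · ext a
      have := congrFun (congrFun hTC a) ⟨0, hn⟩
      rw [Matrix.mul_apply] at this
      simp only [C, C', ctrbMatrix, Matrix.of_apply, pow_zero, Matrix.one_mulVec] at this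
      exact this
  · rcases Nat.eq_zero_or_pos n with rfl | hn
    · exact Subsingleton.elim _ _
    · ext a
      have := congrFun (congrFun hOT ⟨0, hn⟩) a
      simpa [O, O', obsvMatrix, ctrbMatrix, Matrix.mul_apply, Matrix.vecMul, dotProduct] using this

theorem pow_mul_of_intertwine {A P N : Matrix (Fin n) (Fin n) ℝ} (h : A * P = P * N) (t : ℕ) :
    A ^ t * P = P * N ^ t := by
  induction t with
  | zero => simp
  | succ t ih => rw [pow_succ, Matrix.mul_assoc, h, ← Matrix.mul_assoc, ih, Matrix.mul_assoc,
      ← pow_succ]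

theorem IsMinimalRealization.of_similarity {P N : Matrix (Fin n) (Fin n) ℝ} {b' : Fin n → ℝ}
    (h : IsMinimalRealization G A b c) (hP : IsUnit P.det) (hAP : A * P = P * N)
    (hb : P *ᵥ b' = b) : IsMinimalRealization G N b' (c ᵥ* P) := by
  have hchar : N.charpoly = A.charpoly := by
    have hA : A = P * N * P⁻¹ := by
      rw [← hAP, Matrix.mul_assoc, Matrix.mul_nonsing_inv _ hP, Matrix.mul_one]
    have hPu : IsUnit P := (Matrix.isUnit_iff_isUnit_det P).2 hP
    obtain ⟨U, rfl⟩ := hPu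
    rw [hA]
    exact (Matrix.charpoly_units_conj U N).symm
  have hcharC : (N.map (algebraMap ℝ ℂ)).charpoly = (A.map (algebraMap ℝ ℂ)).charpoly := by
    rw [Matrix.charpoly_map, Matrix.charpoly_map, hchar]
  have himp : impulseResponse N b' (c ᵥ* P) = impulseResponse A b c := by
    ext t
    cases t with
    | zero => rw [impulseResponse_zero, impulseResponse_zero]
    | succ t =>
      rw [impulseResponse_succ, impulseResponse_succ, ← hb, ← Matrix.dotProduct_mulVec,
        Matrix.mulVec_mulVec, Matrix.mulVec_mulVec, pow_mul_of_intertwine hAP]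
  refine ⟨⟨fun z hz => h.1.1 z ?_, fun z hz => ?_⟩, ?_⟩
  · rw [Matrix.mem_spectrum_iff_isRoot_charpoly] at hz ⊢
    rwa [← hcharC]
  · rw [himp]; exact h.1.2 z hz
  · rw [hcharC]; exact h.2

end Realizations

/-! ### Internal positivity in terms of minors, and its behaviour under similarity. -/

section Main

variable {n : ℕ}

theorem obsvOp_eq_mulVec (A : Matrix (Fin n) (Fin n) ℝ) (c : Fin n → ℝ) :
    obsvOp A c = fun x => (ctrbKernel Aᵀ c)ᵀ *ᵥ x := by
  ext x t
  have h : (ctrbKernel Aᵀ c)ᵀ t = c ᵥ* A ^ t := transpose_pow_mulVec A c t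
  rw [obsvOp, Matrix.dotProduct_mulVec, ← h]
  rfl

theorem isInternallyHankelKPositive_iff {k : ℕ} (hk : 1 ≤ k) {A : Matrix (Fin n) (Fin n) ℝ}
    {b c : Fin n → ℝ} (hA : IsStable A) :
    IsInternallyHankelKPositive k A b c ↔ IsTotallyNonneg k A ∧
      IsTotallyNonneg k (ctrbKernel A b) ∧ IsTotallyNonneg k (ctrbKernel Aᵀ c)ᵀ := by
  rw [IsInternallyHankelKPositive, obsvOp_eq_mulVec]
  exact and_congr (isOVD_matrix_iff hk A) (and_congr
    (isOVD_tsum_iff hk (x := fun i => A ^ i *ᵥ b) fun u hu => hA.summable b hu)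
    (isOVD_matrix_iff hk _))

theorem IsTotallyNonneg.ctrbCompound_nonneg {k : ℕ} {A : Matrix (Fin n) (Fin n) ℝ}
    {b : Fin n → ℝ} (h : IsTotallyNonneg k (ctrbKernel A b)) {j : ℕ} (hj : j ≤ k)
    (I : Fin j ↪o Fin n) : 0 ≤ ctrbCompound A b j I :=
  h j hj I (fun i => (i : ℕ)) I.strictMono Fin.val_strictMono

theorem obsvCompound_eq_ctrbCompound (A : Matrix (Fin n) (Fin n) ℝ) (c : Fin n → ℝ) (j : ℕ) :
    obsvCompound A c j = ctrbCompound Aᵀ c j := by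
  ext J
  exact Matrix.det_transpose ((ctrbMatrix Aᵀ c j).submatrix J id)

theorem ctrbCompound_of_similarity {A P N : Matrix (Fin n) (Fin n) ℝ} {b b' : Fin n → ℝ}
    (hAP : A * P = P * N) (hb : P *ᵥ b' = b) (j : ℕ) :
    ctrbCompound A b j = compound P j *ᵥ ctrbCompound N b' j := by
  have h : ctrbMatrix A b j = P * ctrbMatrix N b' j := by
    ext i t
    have : A ^ (t : ℕ) *ᵥ b = P *ᵥ (N ^ (t : ℕ) *ᵥ b') := by
      rw [← hb, Matrix.mulVec_mulVec, Matrix.mulVec_mulVec, pow_mul_of_intertwine hAP]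
    exact congrFun this i
  ext I
  rw [ctrbCompound, h, compound_mul]
  rfl

theorem obsvCompound_of_similarity {A P N : Matrix (Fin n) (Fin n) ℝ} {c : Fin n → ℝ}
    (hAP : A * P = P * N) (j : ℕ) :
    obsvCompound A c j ᵥ* compound P j = obsvCompound N (c ᵥ* P) j := by
  have h : obsvMatrix N (c ᵥ* P) j = obsvMatrix A c j * P := by
    ext t i
    have : Nᵀ ^ (t : ℕ) *ᵥ (c ᵥ* P) = (Aᵀ ^ (t : ℕ) *ᵥ c) ᵥ* P := by
      rw [transpose_pow_mulVec, transpose_pow_mulVec, Matrix.vecMul_vecMul, Matrix.vecMul_vecMul,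
        pow_mul_of_intertwine hAP]
    exact congrFun this i
  ext J
  rw [obsvCompound, h, compound_mul]
  rfl

end Main

end HankelPos

theorem mainTheorem3 {n : ℕ} (k : ℕ) (hk : 1 ≤ k) (G : RatFunc ℝ)
    (A : Matrix (Fin n) (Fin n) ℝ) (b c : Fin n → ℝ)
    (hmin : HankelPos.IsMinimalRealization G A b c) :
    (∃ (m : ℕ) (A' : Matrix (Fin m) (Fin m) ℝ) (b' c' : Fin m → ℝ),
      HankelPos.IsMinimalRealization G A' b' c' ∧
      HankelPos.IsInternallyHankelKPositive k A' b' c') ↔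
    ∃ P N : Matrix (Fin n) (Fin n) ℝ,
      P.rank = n ∧ A * P = P * N ∧ HankelPos.IsKPositive k N ∧
      ∀ j, 1 ≤ j → j ≤ k →
        HankelPos.ctrbCompound A b j ∈ HankelPos.cone (HankelPos.compound P j) ∧
        HankelPos.obsvCompound A c j ∈
          HankelPos.dualCone (HankelPos.cone (HankelPos.compound P j)) := by
  open HankelPos in
  constructor
  · rintro ⟨m, A', b', c', hmin', hint⟩
    -- Both orders equal the degree of the denominator of `G`.
    obtain rfl : n = m := hmin.natDegree_denom.symm.trans hmin'.natDegree_denom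
    obtain ⟨hA, hC, hO⟩ := (isInternallyHankelKPositive_iff hk hmin'.1.1).1 hint
    obtain ⟨T, hT, hAT, hb, hc⟩ := hmin.exists_similarity hmin'
    refine ⟨T, A', ?_, hAT, isKPositive_iff_isTotallyNonneg.2 hA, fun j _ hj => ⟨?_, ?_⟩⟩
    · rw [Matrix.rank_of_isUnit T ((Matrix.isUnit_iff_isUnit_det T).2 hT), Fintype.card_fin]
    · exact ⟨ctrbCompound A' b' j, hC.ctrbCompound_nonneg hj,
        ctrbCompound_of_similarity hAT hb j⟩
    · rw [mem_dualCone_cone_iff, obsvCompound_of_similarity hAT, hc, obsvCompound_eq_ctrbCompound]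
      exact IsTotallyNonneg.ctrbCompound_nonneg hO.transpose hj
  · rintro ⟨P, N, hP, hAP, hN, hcone⟩
    have hPu : IsUnit P.det := by
      rw [isUnit_iff_ne_zero]
      intro h0
      obtain ⟨x, hx, hx0⟩ := Matrix.exists_mulVec_eq_zero_iff.2 h0
      have hli : LinearIndependent ℝ P.col := by
        rw [linearIndependent_iff_card_eq_finrank_span, Fintype.card_fin, Set.finrank,
          ← Matrix.rank_eq_finrank_span_cols, hP]
      exact hx (Matrix.mulVec_injective_iff.2 hli (by rw [hx0, Matrix.mulVec_zero]))
    have hb : P *ᵥ (P⁻¹ *ᵥ b) = b := by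
      rw [Matrix.mulVec_mulVec, Matrix.mul_nonsing_inv _ hPu, Matrix.one_mulVec]
    have hmin' := hmin.of_similarity hPu hAP hb
    have hNT := isKPositive_iff_isTotallyNonneg.1 hN
    refine ⟨n, N, P⁻¹ *ᵥ b, c ᵥ* P, hmin',
      (isInternallyHankelKPositive_iff hk hmin'.1.1).2 ⟨hNT, ?_, ?_⟩⟩
    · refine isTotallyNonneg_ctrbKernel hNT hmin'.controllable fun j hj hjk => ?_
      obtain ⟨x, hx, hxP⟩ := (hcone j hj hjk).1
      rw [ctrbCompound_of_similarity hAP hb] at hxP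
      -- `compound P j` is invertible, so the nonnegative coefficient vector from the cone condition
      -- is the compound in the new coordinates.
      have h1 := congrArg (fun v => compound P⁻¹ j *ᵥ v) hxP
      simp only [Matrix.mulVec_mulVec, ← compound_mul, Matrix.nonsing_inv_mul _ hPu, compound_one,
        Matrix.one_mulVec] at h1
      rw [h1]
      exact hx
    -- Observability is controllability of the transposed pair, and the dual cone condition is the
    -- nonnegativity of its compounds in the new coordinates.
    · refine (isTotallyNonneg_ctrbKernel hNT.transpose hmin'.observable fun j hj hjk => ?_).transpose
      have h2 := mem_dualCone_cone_iff.1 (hcone j hj hjk).2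
      rwa [obsvCompound_of_similarity hAP, obsvCompound_eq_ctrbCompound] at h2
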